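/- Let $k$ be a perfect field with algebraic closure $\bar k$, and let $c,d\in k^*$ be such that the quaternion algebra $(c,d)$ over $k$ is not split. Put $l=k(\sqrt d)$, and assume that $l/k$ is a quadratic Galois extension (i.e. $\operatorname{char} k\neq 2$). Let $E$ be the quotient field of $k[x,y]/\langle 1-cx^2-dy^2\rangle$ and $u=(1+\sqrt d\,y)/x$, so that $El=l(u)$ and $E\bar k=\bar k(u)$. For a field $K$ with $l\subseteq K\subseteq\bar k$ let $G_K=\mathrm{Gal}(\bar k/K)$ and $X(K)=H^1(G_K,\mathbb{Q}/\mathbb{Z})$. Let $\sigma\in G_k$ be an element that is nontrivial on $l$, and let $s$ be the automorphism of $\bar k(u)$ over $E$ with $s|_{\bar k}=\sigma$ (so $s(u)=c/u$). Let $\mathrm{Br}(l)=H^2(G_l,\bar k^*)$ and $\mathrm{Br}(l(u))=H^2(G_l,\bar k(u)^*)$, where $G_l$ acts on $\bar k(u)$ through the coefficients; let $s^*$ be the automorphism of $\mathrm{Br}(l(u))$ given on 2-cocycles by $(s^*h)(g_1,g_2)=s\bigl(h(\sigma^{-1}g_1\sigma,\sigma^{-1}g_2\sigma)\bigr)$,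 and let $\sigma$ act on $X(l)$ by $(\sigma\chi)(g)=\chi(\sigma^{-1}g\sigma)$. For every monic irreducible $p\in l[u]$ with $p\neq u$ fix a root $a_p\in\bar k$ of $p$. Let $$\Phi\colon \mathrm{Br}(l)\oplus X(l)\oplus\bigoplus_p X(l(a_p))\longrightarrow \mathrm{Br}(l(u))$$ be the Auslander–Brumer–Faddeev isomorphism. It is given on $\mathrm{Br}(l)$ by the inclusion $\bar k^*\subset\bar k(u)^*$; on $X(l)$ by $X(l)\xrightarrow{\delta}H^2(G_l,\mathbb{Z})\xrightarrow{\pi^*}H^2(G_l,\langle u\rangle)\to \mathrm{Br}(l(u))$ with $\pi(e)=u^e$; and on $X(l(a_p))$, with $H=G_{l(a_p)}$ and $A=\mathrm{Hom}_H(G_l,\mathbb{Z})$ the coinduced module, by $$X(l(a_p))\xrightarrow{\delta}H^2(H,\mathbb{Z})\xrightarrow{\mathrm{sh}}H^2(G_l,A)\xrightarrow{\iota^*}\mathrm{Br}(l(u)),\qquad \iota(x)=\prod_{\tau H\in G_l/H}(u-\tau(a_p))^{x(\tau^{-1})}.$$ Here $\delta$ is the connecting homomorphism of $0\to\mathbb{Z}\to\mathbb{Q}\to\mathbb{Q}/\mathbb{Z}\to0$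 and $\mathrm{sh}$ is the isomorphism of Shapiro's lemma. Let $s^*_{pu}\colon X(l(a_p))\to X(l)$ be the component of $s^*$ in this decomposition, i.e. $s^*_{pu}(\chi)$ is the $X(l)$-component of $\Phi^{-1}(s^*(\Phi(\chi)))$. Then for every $p$ and every $\chi\in X(l(a_p))$ $$s^*_{pu}(\chi)=-\sigma\bigl(\mathrm{Cor}_{l(a_p)/l}(\chi)\bigr).$$ Explicitly: for $\psi\in X(l)$ there exist $\beta\in\mathrm{Br}(l)$ and $\xi\in\bigoplus_q X(l(a_q))$ with $s^*(\Phi(\chi))=\Phi(\beta\oplus\psi\oplus\xi)$ if and only if $\psi=-\sigma(\mathrm{Cor}_{l(a_p)/l}(\chi))$. -/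

import Mathlib

open scoped DirectSum

noncomputable section

namespace GenusZero

/-! ### Continuous cohomology of a topological group with discrete coefficients -/

/-- The discrete group `ℚ/ℤ`.  (Continuity of maps into a discrete group is always expressed
by `IsLocallyConstant`, so that no topology on the coefficients is needed.) -/
abbrev QmodZ : Type := ℚ ⧸ AddSubgroup.zmultiples (1 : ℚ)

section Cohomology

variable {G G' M M' : Type*} [Group G] [TopologicalSpace G] [Group G'] [TopologicalSpace G']
  [AddCommGroup M] [AddCommGroup M']

/-- Continuous (inhomogeneous) 2-cocycles of `G` in the discrete `G`-module `(M, ρ)`. -/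
def Z2 (ρ : Representation ℤ G M) : AddSubgroup (G × G → M) where
  carrier := {f | IsLocallyConstant f ∧
    ∀ g h j, ρ g (f (h, j)) - f (g * h, j) + f (g, h * j) - f (g, h) = 0}
  zero_mem' := ⟨IsLocallyConstant.const 0, fun _ _ _ => by simp⟩
  add_mem' := fun {f f'} hf hf' => ⟨hf.1.add hf'.1, fun g h j => by
    have h1 := hf.2 g h j
    have h2 := hf'.2 g h j
    simp only [Pi.add_apply, map_add]
    rw [← add_zero (0 : M)]
    nth_rewrite 1 [← h1]
    rw [← h2]
    abel⟩
  neg_mem' := fun {f} hf => ⟨hf.1.neg, fun g h j => by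
    have h1 := hf.2 g h j
    simp only [Pi.neg_apply, map_neg]
    rw [← neg_zero, ← h1]
    abel⟩

/-- The 2-cocycles that are coboundaries of continuous 1-cochains. -/
def B2 (ρ : Representation ℤ G M) : AddSubgroup (Z2 ρ) where
  carrier := {f | ∃ b : G → M, IsLocallyConstant b ∧
    ∀ g h, f.1 (g, h) = ρ g (b h) - b (g * h) + b g}
  zero_mem' := ⟨0, IsLocallyConstant.const 0, fun _ _ => by simp⟩
  add_mem' := by
    rintro f f' ⟨b, hb, hf⟩ ⟨b', hb', hf'⟩
    refine ⟨b + b', hb.add hb', fun g h => ?_⟩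
    simp only [AddSubgroup.coe_add, Pi.add_apply, hf, hf', map_add]
    abel
  neg_mem' := by
    rintro f ⟨b, hb, hf⟩
    refine ⟨-b, hb.neg, fun g h => ?_⟩
    simp only [AddSubgroup.coe_neg, Pi.neg_apply, hf, map_neg]
    abel

/-- The second continuous cohomology group `H²(G, M)`. -/
def H2 (ρ : Representation ℤ G M) : Type _ := Z2 ρ ⧸ B2 ρ

instance (ρ : Representation ℤ G M) : AddCommGroup (H2 ρ) :=
  inferInstanceAs (AddCommGroup (Z2 ρ ⧸ B2 ρ))

/-- The class of a 2-cocycle. -/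
def H2.mk (ρ : Representation ℤ G M) : Z2 ρ →+ H2 ρ := QuotientAddGroup.mk' (B2 ρ)

/-- The map on 2-cocycles `f ↦ φ ∘ f ∘ (c × c)` induced by a compatible pair of homomorphisms
`c : G' → G`, `φ : M → M'`. -/
def Z2.map {ρ : Representation ℤ G M} {ρ' : Representation ℤ G' M'} (c : G' →* G)
    (hc : Continuous c) (φ : M →+ M') (hφ : ∀ g m, φ (ρ (c g) m) = ρ' g (φ m)) :
    Z2 ρ →+ Z2 ρ' where
  toFun f := ⟨fun q => φ (f.1 (c q.1, c q.2)),
    (f.2.1.comp_continuous (hc.prodMap hc)).comp φ, fun g h j => by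
      have h1 := f.2.2 (c g) (c h) (c j)
      simp only [← hφ, map_mul, ← map_sub, ← map_add, h1, map_zero]⟩
  map_zero' := by ext; simp
  map_add' _ _ := by ext; simp

/-- The map `H²(G, M) → H²(G', M')` induced by a compatible pair of homomorphisms
`c : G' → G`, `φ : M → M'`. -/
def H2.map {ρ : Representation ℤ G M} {ρ' : Representation ℤ G' M'} (c : G' →* G)
    (hc : Continuous c) (φ : M →+ M') (hφ : ∀ g m, φ (ρ (c g) m) = ρ' g (φ m)) :
    H2 ρ →+ H2 ρ' :=
  QuotientAddGroup.map _ _ (Z2.map c hc φ hφ) (by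
    rintro f ⟨b, hb, hf⟩
    refine ⟨fun g => φ (b (c g)), (hb.comp_continuous hc).comp φ, fun g h => ?_⟩
    simp [Z2.map, hf, hφ])

variable (G) in
/-- The character group `X(G) = H¹(G, ℚ/ℤ)`: the continuous homomorphisms from `G` to the discrete
group `ℚ/ℤ` (the action being trivial, these are the continuous 1-cocycles, and
1-coboundaries vanish). -/
def Character : AddSubgroup (G → QmodZ) where
  carrier := {χ | IsLocallyConstant χ ∧ ∀ g h, χ (g * h) = χ g + χ h}
  zero_mem' := ⟨IsLocallyConstant.const 0, fun _ _ => by simp⟩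
  add_mem' := fun hf hf' => ⟨hf.1.add hf'.1, fun g h => by
    simp only [Pi.add_apply, hf.2, hf'.2]; abel⟩
  neg_mem' := fun hf => ⟨hf.1.neg, fun g h => by
    simp only [Pi.neg_apply, hf.2]; abel⟩

/-- Pullback of characters along a continuous homomorphism. -/
def Character.comap (c : G' →* G) (hc : Continuous c) : Character G →+ Character G' where
  toFun χ := ⟨fun g => χ.1 (c g), χ.2.1.comp_continuous hc, fun g h => by
    change χ.1 (c (g * h)) = _
    rw [map_mul, χ.2.2]⟩
  map_zero' := rfl
  map_add' _ _ := rfl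

/-! ### The connecting homomorphism `δ` of `0 → ℤ → ℚ → ℚ/ℤ → 0` -/

/-- If a rational number is zero in `ℚ/ℤ`, it is the integer `⌊q⌋`. -/
lemma floor_of_mk_eq_zero {q : ℚ} (h : (q : QmodZ) = 0) : ((⌊q⌋ : ℤ) : ℚ) = q := by
  rw [QuotientAddGroup.eq_zero_iff, AddSubgroup.mem_zmultiples_iff] at h
  obtain ⟨n, rfl⟩ := h
  simp

lemma mk_out (x : QmodZ) : ((x.out : ℚ) : QmodZ) = x := QuotientAddGroup.out_eq' x

/-- The coboundary of the lift `g ↦ (χ g).out` of a character to a `ℚ`-valued cochain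
is integral. -/
lemma delta_mk (χ : Character G) (g h : G) :
    ((((χ.1 h).out - (χ.1 (g * h)).out + (χ.1 g).out : ℚ)) : QmodZ) = 0 := by
  rw [QuotientAddGroup.mk_add, QuotientAddGroup.mk_sub, mk_out, mk_out, mk_out, χ.2.2]
  abel

/-- The 2-cocycle `(g, h) ↦ χ̃ h - χ̃ (g h) + χ̃ g` where `χ̃ : G → ℚ` lifts `χ`. -/
def deltaCocycle (χ : Character G) : Z2 (Representation.trivial ℤ G ℤ) :=
  ⟨fun q => ⌊((χ.1 q.2).out - (χ.1 (q.1 * q.2)).out + (χ.1 q.1).out : ℚ)⌋, by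
    simp only [χ.2.2]
    exact ((χ.2.1.comp_continuous continuous_fst).prodMk
      (χ.2.1.comp_continuous continuous_snd)).comp
      (fun x : QmodZ × QmodZ => ⌊(x.2.out - (x.1 + x.2).out + x.1.out : ℚ)⌋), fun g h j => by
    have key : ∀ g h, ((⌊((χ.1 h).out - (χ.1 (g * h)).out + (χ.1 g).out : ℚ)⌋ : ℤ) : ℚ) = _ :=
      fun g h => floor_of_mk_eq_zero (delta_mk χ g h)
    rw [← Int.cast_inj (α := ℚ)]
    simp only [Representation.trivial_apply, Int.cast_sub, Int.cast_add, key, Int.cast_zero]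
    rw [mul_assoc]
    ring⟩

/-- The connecting homomorphism `δ : H¹(G, ℚ/ℤ) → H²(G, ℤ)`. -/
def delta : Character G →+ H2 (Representation.trivial ℤ G ℤ) :=
  AddMonoidHom.mk' (fun χ => H2.mk _ (deltaCocycle χ)) fun χ ψ => by
    rw [← map_add, eq_comm]
    refine QuotientAddGroup.eq.mpr ?_
    refine ⟨fun g => ⌊(((χ + ψ).1 g).out - (χ.1 g).out - (ψ.1 g).out : ℚ)⌋,
      ((χ + ψ).2.1.prodMk (χ.2.1.prodMk ψ.2.1)).comp
        (fun x : QmodZ × QmodZ × QmodZ => ⌊(x.1.out - x.2.1.out - x.2.2.out : ℚ)⌋),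
      fun g h => ?_⟩
    have key : ∀ (χ : Character G) g h,
        ((⌊((χ.1 h).out - (χ.1 (g * h)).out + (χ.1 g).out : ℚ)⌋ : ℤ) : ℚ) = _ :=
      fun χ g h => floor_of_mk_eq_zero (delta_mk χ g h)
    have key2 : ∀ g, ((⌊(((χ + ψ).1 g).out - (χ.1 g).out - (ψ.1 g).out : ℚ)⌋ : ℤ) : ℚ) = _ :=
      fun g => floor_of_mk_eq_zero (by
        rw [QuotientAddGroup.mk_sub, QuotientAddGroup.mk_sub, mk_out, mk_out, mk_out]
        change χ.1 g + ψ.1 g - _ - _ = 0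
        abel)
    rw [← Int.cast_inj (α := ℚ)]
    simp only [deltaCocycle, AddSubgroup.coe_add, AddSubgroup.coe_neg, Pi.add_apply, Pi.neg_apply,
      Representation.trivial_apply, Int.cast_sub, Int.cast_add, Int.cast_neg] at key key2 ⊢
    have k3 := key (χ + ψ) g h
    simp only [AddSubgroup.coe_add, Pi.add_apply] at k3
    rw [key, key, key2, key2, key2, k3]
    ring

end Cohomology

/-! ### Shapiro's map and corestriction for an open subgroup of finite index -/

section OpenSubgroup

variable {G : Type*} [Group G]

section Shapiro

variable (H : Subgroup G)

/-- The `G`-module `A = Ind_G^H ℤ = Hom_H(G, ℤ)` of functions `x : G → ℤ` with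
`x (h g) = x g` for `h ∈ H`, with `G`-action `(g x)(g₁) = x (g₁ g)`. -/
abbrev indZ : Representation ℤ G
    (Representation.coindV H.subtype (Representation.trivial ℤ H ℤ)) :=
  Representation.coind H.subtype (Representation.trivial ℤ H ℤ)

lemma indZ_apply (g g₁ : G)
    (x : Representation.coindV H.subtype (Representation.trivial ℤ H ℤ)) :
    (indZ H g x).1 g₁ = x.1 (g₁ * g) := rfl

lemma coindV_mul (x : Representation.coindV H.subtype (Representation.trivial ℤ H ℤ))
    (h : H) (g : G) : x.1 (h * g) = x.1 g := x.2 h g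

/-- Representatives for the cosets `τ H`, the trivial coset being represented by `1`. -/
def cosetRep (q : G ⧸ H) : G := by
  classical
  exact if q = ((1 : G) : G ⧸ H) then 1 else q.out

lemma mk_cosetRep (q : G ⧸ H) : ((cosetRep H q : G) : G ⧸ H) = q := by
  unfold cosetRep
  split_ifs with h
  · exact h.symm
  · exact QuotientGroup.out_eq' q

/-- The left `H`-equivariant retraction `G → H` which writes `g = (retr g) · t` with `t⁻¹` the
chosen representative of the coset `g⁻¹ H`. -/
def retr (g : G) : H :=
  ⟨g * cosetRep H ((g⁻¹ : G) : G ⧸ H), by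
    have h := QuotientGroup.eq.mp (mk_cosetRep H ((g⁻¹ : G) : G ⧸ H)).symm
    rwa [inv_inv] at h⟩

lemma retr_mul (h : H) (g : G) : retr H (h * g) = h * retr H g := by
  have : (((h * g : G)⁻¹ : G) : G ⧸ H) = ((g⁻¹ : G) : G ⧸ H) := by
    rw [QuotientGroup.eq]
    simp
  ext
  simp only [retr, this, Subgroup.coe_mul, mul_assoc]

lemma retr_coe (h : H) : retr H (h : G) = h := by
  have : (((h : G)⁻¹ : G) : G ⧸ H) = ((1 : G) : G ⧸ H) := by
    rw [QuotientGroup.eq]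
    simp
  ext
  simp [retr, this, cosetRep]

/-- Since `H` has finite index, a family of elements of `Ind_G^H ℤ` is locally constant as soon
as all its values are. -/
lemma isLocallyConstant_coindV [H.FiniteIndex] {Y : Type*} [TopologicalSpace Y]
    (F : Y → Representation.coindV H.subtype (Representation.trivial ℤ H ℤ))
    (hF : ∀ g, IsLocallyConstant fun y => (F y).1 g) : IsLocallyConstant F := by
  rw [IsLocallyConstant.iff_eventually_eq]
  intro y
  have h2 : ∀ᶠ y' in nhds y, ∀ c : G ⧸ H, (F y').1 c.out⁻¹ = (F y).1 c.out⁻¹ :=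
    Filter.eventually_all.mpr fun c => (hF _).eventually_eq y
  filter_upwards [h2] with y' hy'
  ext g
  obtain ⟨h, hh⟩ : ∃ h : H, g = h * (((g⁻¹ : G) : G ⧸ H).out)⁻¹ :=
    ⟨⟨g * ((g⁻¹ : G) : G ⧸ H).out, by
      have h := QuotientGroup.eq.mp (QuotientGroup.out_eq' ((g⁻¹ : G) : G ⧸ H)).symm
      rwa [inv_inv] at h⟩, by simp⟩
  rw [hh, coindV_mul, coindV_mul]
  exact hy' _

variable [TopologicalSpace G] [IsTopologicalGroup G]

lemma continuous_retr (hH : IsOpen (H : Set G)) : Continuous (retr H) := by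
  have := QuotientGroup.discreteTopology hH
  refine Continuous.subtype_mk (continuous_id.mul ?_) _
  exact (continuous_of_discreteTopology (f := cosetRep H)).comp
    (QuotientGroup.continuous_mk.comp continuous_inv)

variable [H.FiniteIndex]

/-- Shapiro's map on cocycles: in terms of homogeneous cochains it sends `f` to
`F (g₀, g₁, g₂) (g) = f (retr (g g₀), retr (g g₁), retr (g g₂))`. -/
def shapiroCocycle (hH : IsOpen (H : Set G)) :
    Z2 (Representation.trivial ℤ H ℤ) →+ Z2 (indZ H) where
  toFun f := ⟨fun q => ⟨fun g => f.1 ((retr H g)⁻¹ * retr H (g * q.1),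
      (retr H (g * q.1))⁻¹ * retr H (g * q.1 * q.2)), fun h g => by
        simp only [Subgroup.subtype_apply, mul_assoc, retr_mul, mul_inv_rev, inv_mul_cancel_left,
          Representation.trivial_apply]⟩, by
    have hr := continuous_retr H hH
    exact isLocallyConstant_coindV H _ fun g => f.2.1.comp_continuous (by fun_prop),
    fun g h j => by
      ext g₀
      have := f.2.2 ((retr H g₀)⁻¹ * retr H (g₀ * g))
        ((retr H (g₀ * g))⁻¹ * retr H (g₀ * g * h))
        ((retr H (g₀ * g * h))⁻¹ * retr H (g₀ * g * h * j))
      simp only [Submodule.coe_add, Submodule.coe_sub, Pi.add_apply, Pi.sub_apply, indZ_apply,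
        ZeroMemClass.coe_zero, Pi.zero_apply]
      simpa [mul_assoc] using this⟩
  map_zero' := by ext; simp
  map_add' _ _ := by ext; simp

/-- The map `sh : H²(H, ℤ) → H²(G, Ind_G^H ℤ)` of Shapiro's lemma. -/
def shapiro (hH : IsOpen (H : Set G)) :
    H2 (Representation.trivial ℤ H ℤ) →+ H2 (indZ H) :=
  QuotientAddGroup.map _ _ (shapiroCocycle H hH) (by
    rintro f ⟨b, hb, hf⟩
    have hr := continuous_retr H hH
    refine ⟨fun g => ⟨fun g₀ => b ((retr H g₀)⁻¹ * retr H (g₀ * g)), fun h g => by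
        simp only [Subgroup.subtype_apply, mul_assoc, retr_mul, mul_inv_rev, inv_mul_cancel_left,
          Representation.trivial_apply]⟩,
      isLocallyConstant_coindV H _ fun g => hb.comp_continuous (by fun_prop), fun g h => ?_⟩
    ext g₀
    simp only [Submodule.coe_add, Submodule.coe_sub, Pi.add_apply, Pi.sub_apply, indZ_apply]
    simp [shapiroCocycle, hf, mul_assoc])

/-- `sh` is inverse to the map `H²(G, Ind_G^H ℤ) → H²(H, ℤ)` induced by the
inclusion `H → G` and the evaluation `x ↦ x 1`. -/
lemma shapiro_spec (hH : IsOpen (H : Set G)) (α : H2 (Representation.trivial ℤ H ℤ)) :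
    H2.map (ρ := indZ H) (ρ' := Representation.trivial ℤ H ℤ) H.subtype continuous_subtype_val
      (AddMonoidHom.mk' (fun x => x.1 1) fun _ _ => rfl)
      (fun h x => by
        change x.1 (1 * h) = x.1 1
        rw [one_mul, ← mul_one (h : G), coindV_mul]) (shapiro H hH α) = α := by
  obtain ⟨f, rfl⟩ := QuotientAddGroup.mk_surjective α
  change QuotientAddGroup.mk _ = QuotientAddGroup.mk _
  congr 1
  ext ⟨g, h⟩
  have h1 := retr_coe H 1
  have h2 := retr_coe H (g * h)
  simp only [Subgroup.coe_one, Subgroup.coe_mul] at h1 h2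
  simp [Z2.map, shapiroCocycle, retr_coe, h1, h2]

end Shapiro

section Corestriction

variable [TopologicalSpace G] [IsTopologicalGroup G] {H : Subgroup G}

/-- A character as a homomorphism to the multiplicative version of `ℚ/ℤ`. -/
def toHom (χ : Character H) : H →* Multiplicative QmodZ where
  toFun h := Multiplicative.ofAdd (χ.1 h)
  map_one' := by
    have := χ.2.2 1 1
    rw [mul_one, left_eq_add] at this
    rw [this]; rfl
  map_mul' g h := by rw [χ.2.2]; rfl

/-- The corestriction `H¹(H, ℚ/ℤ) → H¹(G, ℚ/ℤ)` for an open subgroup of finite index, given by the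
usual formula for the trivial module `ℚ/ℤ`: `(cor χ)(g) = ∑ χ (τ⁻¹ g τ')`, the sum being over
representatives `τ` of the cosets `τ H`, with `τ'` the representative of `g⁻¹ τ H`; in other
words, by composition with the transfer. -/
def cor [H.FiniteIndex] (hH : IsOpen (H : Set G)) : Character H →+ Character G where
  toFun χ := ⟨fun g => (MonoidHom.transfer (toHom χ) g).toAdd, by
    have := QuotientGroup.discreteTopology hH
    let := H.fintypeQuotientOfFiniteIndex
    have h1 : ∀ q : G ⧸ H, IsLocallyConstant fun g : G => χ.1
      ⟨((default : H.LeftTransversal).2.leftQuotientEquiv q : G)⁻¹ *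
        ((g • (default : H.LeftTransversal)).2.leftQuotientEquiv q : G),
        QuotientGroup.leftRel_apply.mp <| Quotient.exact'
          (((default : H.LeftTransversal).2.leftQuotientEquiv.symm_apply_apply q).trans
            ((g • (default : H.LeftTransversal)).2.leftQuotientEquiv.symm_apply_apply q).symm)⟩ := by
      intro q
      refine χ.2.1.comp_continuous (Continuous.subtype_mk (continuous_const.mul ?_) _)
      simp only [Subgroup.smul_apply_eq_smul_apply_inv_smul]
      refine continuous_id.mul ?_
      refine (continuous_of_discreteTopology (f := fun q : G ⧸ H =>
        ((default : H.LeftTransversal).2.leftQuotientEquiv q : G))).comp ?_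
      exact (continuous_inv.smul continuous_const)
    rw [IsLocallyConstant.iff_eventually_eq]
    intro g
    filter_upwards [Filter.eventually_all.mpr fun q => (h1 q).eventually_eq g] with g' hg'
    simp only [MonoidHom.transfer, MonoidHom.coe_mk, OneHom.coe_mk,
      Subgroup.leftTransversals.diff, toHom]
    congr 1
    exact Finset.prod_congr rfl fun q _ => congrArg Multiplicative.ofAdd (hg' q),
    fun g h =>
    congrArg Multiplicative.toAdd (map_mul (MonoidHom.transfer (toHom χ)) g h)⟩
  map_zero' := by
    ext g
    simp only [MonoidHom.transfer, MonoidHom.coe_mk, OneHom.coe_mk,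
      Subgroup.leftTransversals.diff, toHom]
    exact Finset.prod_eq_one (M := Multiplicative QmodZ) fun q _ => rfl
  map_add' χ ψ := by
    ext g
    simp only [MonoidHom.transfer, MonoidHom.coe_mk, OneHom.coe_mk,
      Subgroup.leftTransversals.diff, toHom]
    exact Finset.prod_mul_distrib (M := Multiplicative QmodZ)

end Corestriction

end OpenSubgroup

/-! ### Semilinear endomorphisms of a rational function field -/

section RatFunc

variable {K : Type*} [Field K]

lemma eval₂_injective (g : K →+* K) {y : RatFunc K} (hy : Transcendental K y) :
    Function.Injective (Polynomial.eval₂RingHom ((algebraMap K (RatFunc K)).comp g) y) := by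
  rw [injective_iff_map_eq_zero]
  intro p hp
  have h1 : Polynomial.aeval y (p.map g) = 0 := by
    rw [Polynomial.aeval_def, Polynomial.eval₂_map]
    exact hp
  have h2 := (transcendental_iff.mp hy) _ h1
  rwa [Polynomial.map_eq_zero] at h2

/-- The ring endomorphism of `K(u)` which is `g` on constants and sends `u` to `y`, where `y` is
transcendental over `K`. -/
def subst (g : K →+* K) (y : RatFunc K) (hy : Transcendental K y) : RatFunc K →+* RatFunc K :=
  IsFractionRing.lift (A := Polynomial K) (eval₂_injective g hy)

lemma subst_algebraMap (g : K →+* K) (y : RatFunc K) (hy : Transcendental K y) (a : K) :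
    subst g y hy (algebraMap K (RatFunc K) a) = algebraMap K (RatFunc K) (g a) := by
  rw [IsScalarTower.algebraMap_apply K (Polynomial K) (RatFunc K), subst,
    IsFractionRing.lift_algebraMap]
  simp [Polynomial.algebraMap_eq]

lemma subst_X (g : K →+* K) (y : RatFunc K) (hy : Transcendental K y) :
    subst g y hy RatFunc.X = y := by
  rw [← RatFunc.algebraMap_X, subst, IsFractionRing.lift_algebraMap]
  simp

lemma ratFunc_hom_ext {L : Type*} [Field L] {φ ψ : RatFunc K →+* L}
    (h1 : ∀ a, φ (algebraMap K (RatFunc K) a) = ψ (algebraMap K (RatFunc K) a))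
    (h2 : φ RatFunc.X = ψ RatFunc.X) : φ = ψ := by
  refine IsLocalization.ringHom_ext (nonZeroDivisors (Polynomial K)) ?_
  refine Polynomial.ringHom_ext (fun a => ?_) ?_
  · simpa [← Polynomial.algebraMap_eq, ← IsScalarTower.algebraMap_apply] using h1 a
  · simpa using h2

lemma transcendental_div_X {c : K} (hc : c ≠ 0) :
    Transcendental K (algebraMap K (RatFunc K) c / RatFunc.X) := by
  intro h
  have h1 : IsAlgebraic K (algebraMap K (RatFunc K) c *
      (algebraMap K (RatFunc K) c / RatFunc.X)⁻¹) := (isAlgebraic_algebraMap c).mul h.inv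
  have hc' : algebraMap K (RatFunc K) c ≠ 0 := by simpa using hc
  rw [inv_div, mul_div_cancel₀ _ hc'] at h1
  exact RatFunc.transcendental_X h1

end RatFunc

/-! ### The genus zero field -/

open Polynomial IntermediateField

/-- The data attached to a genus zero extension `E` of `k`, the quotient field of
`k[x, y] / (1 - c x² - d y²)`, which is not a rational function field: the elements `c, d`, such
that the quaternion algebra `(c, d)` is not split, a square root of `d` in the algebraic closure
`kbar` of `k`, and an element `σ` of the absolute Galois group of `k` that restricts to the
nontrivial element of the Galois group of `l = k(√d)` over `k`. -/
structure ConicData (k kbar : Type*) [Field k] [Field kbar] [Algebra k kbar] where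
  (c d : k)
  c_ne_zero : c ≠ 0
  d_ne_zero : d ≠ 0
  not_split : IsEmpty (QuaternionAlgebra k c 0 d ≃ₐ[k] Matrix (Fin 2) (Fin 2) k)
  sqrtD : kbar
  sqrtD_sq : sqrtD ^ 2 = algebraMap k kbar d
  σ : Gal(kbar/k)
  σ_sqrtD_ne : σ sqrtD ≠ sqrtD

namespace ConicData

variable {k kbar : Type*} [Field k] [Field kbar] [Algebra k kbar] (S : ConicData k kbar)

/-- The field `l = k(√d)`. -/
def l : IntermediateField k kbar := k⟮S.sqrtD⟯

/-- The absolute Galois group `G_l` of `l`, as a subgroup of the one of `k`. -/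
abbrev Gl : Subgroup Gal(kbar/k) := S.l.fixingSubgroup

lemma σ_sqrtD : S.σ S.sqrtD = -S.sqrtD := by
  have h : (S.σ S.sqrtD) ^ 2 = S.sqrtD ^ 2 := by
    rw [← map_pow, S.sqrtD_sq, AlgEquiv.commutes]
  exact (sq_eq_sq_iff_eq_or_eq_neg.mp h).resolve_left S.σ_sqrtD_ne

lemma sqrtD_ne_zero : S.sqrtD ≠ 0 := fun h => by simpa [h] using S.σ_sqrtD_ne

lemma two_ne_zero (S : ConicData k kbar) : (2 : kbar) ≠ 0 := fun h => S.σ_sqrtD_ne <| by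
  rw [S.σ_sqrtD, neg_eq_iff_add_eq_zero, ← two_mul, h, zero_mul]

lemma mem_Gl (g : Gal(kbar/k)) : g ∈ S.Gl ↔ g S.sqrtD = S.sqrtD := by
  rw [Gl, IntermediateField.mem_fixingSubgroup_iff]
  constructor
  · exact fun h => h _ (IntermediateField.mem_adjoin_simple_self k S.sqrtD)
  · intro h x hx
    induction hx using IntermediateField.adjoin_induction with
    | mem x hx => rw [Set.mem_singleton_iff] at hx; rw [hx, h]
    | algebraMap x => simp
    | add x y _ _ hx hy => rw [map_add, hx, hy]
    | inv x _ hx => rw [map_inv₀, hx]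
    | mul x y _ _ hx hy => rw [map_mul, hx, hy]

lemma conj_mem {g : Gal(kbar/k)} (hg : g ∈ S.Gl) : S.σ⁻¹ * g * S.σ ∈ S.Gl := by
  rw [mem_Gl] at hg ⊢
  have h : S.σ⁻¹ S.sqrtD = -S.sqrtD := by
    rw [← neg_eq_iff_eq_neg, ← map_neg, ← S.σ_sqrtD]
    exact S.σ.symm_apply_apply _
  simp only [AlgEquiv.mul_apply, S.σ_sqrtD, map_neg, hg, h, neg_neg]

/-- Conjugation `g ↦ σ⁻¹ g σ` on `G_l`. -/
def conj : S.Gl →* S.Gl where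
  toFun g := ⟨S.σ⁻¹ * g * S.σ, S.conj_mem g.2⟩
  map_one' := by ext; simp
  map_mul' g h := by
    apply Subtype.ext
    simp only [Subgroup.coe_mul]
    group

lemma continuous_conj : Continuous S.conj :=
  ((continuous_const.mul continuous_subtype_val).mul continuous_const).subtype_mk _

/-- The natural action of `σ` on `X(l) = H¹(G_l, ℚ/ℤ)`: `(σ χ)(g) = χ (σ⁻¹ g σ)`. -/
def sigmaX : Character S.Gl →+ Character S.Gl := Character.comap S.conj S.continuous_conj

/-! #### The field `E` inside `kbar(u)` and the automorphism `s` -/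

/-- The element `x = 2 / (u + c/u)` of `kbar(u)`. -/
def xE : RatFunc kbar := 2 / (RatFunc.X + algebraMap k (RatFunc kbar) S.c / RatFunc.X)

/-- The element `y = (2u / (u + c/u) - 1) / √d` of `kbar(u)`. -/
def yE : RatFunc kbar :=
  (2 * RatFunc.X / (RatFunc.X + algebraMap k (RatFunc kbar) S.c / RatFunc.X) - 1) /
    algebraMap kbar (RatFunc kbar) S.sqrtD

/-- The field `E = k(x, y)`, as a subfield of `E kbar = kbar(u)`, where `c x² + d y² = 1` and
`u = (1 + √d y) / x`. -/
def E : IntermediateField k (RatFunc kbar) := IntermediateField.adjoin k {S.xE, S.yE}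

lemma X_sq_add_ne_zero :
    ((RatFunc.X : RatFunc kbar) ^ 2 + algebraMap k (RatFunc kbar) S.c) ≠ 0 := by
  intro h
  refine RatFunc.transcendental_X (K := kbar) ⟨X ^ 2 + C (algebraMap k kbar S.c), ?_, ?_⟩
  · exact (Polynomial.monic_X_pow_add_C _ (by norm_num)).ne_zero
  · rw [map_add, map_pow, Polynomial.aeval_X, Polynomial.aeval_C,
      ← IsScalarTower.algebraMap_apply, h]

lemma X_add_eq : (RatFunc.X + algebraMap k (RatFunc kbar) S.c / RatFunc.X : RatFunc kbar) =
    (RatFunc.X ^ 2 + algebraMap k (RatFunc kbar) S.c) / RatFunc.X := by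
  have h0 : (RatFunc.X : RatFunc kbar) ≠ 0 := RatFunc.X_ne_zero
  field_simp

lemma algebraMap_sqrtD_ne_zero : algebraMap kbar (RatFunc kbar) S.sqrtD ≠ 0 := by
  simpa using S.sqrtD_ne_zero

/-- `x` and `y` satisfy the equation of the conic. -/
lemma conic_equation : algebraMap k (RatFunc kbar) S.c * S.xE ^ 2 +
    algebraMap k (RatFunc kbar) S.d * S.yE ^ 2 = 1 := by
  have h0 : (RatFunc.X : RatFunc kbar) ≠ 0 := RatFunc.X_ne_zero
  have h1 := S.X_sq_add_ne_zero
  have h2 := S.algebraMap_sqrtD_ne_zero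
  have h3 : algebraMap k (RatFunc kbar) S.d = (algebraMap kbar (RatFunc kbar) S.sqrtD) ^ 2 := by
    rw [← map_pow, S.sqrtD_sq, ← IsScalarTower.algebraMap_apply]
  rw [xE, yE, h3, X_add_eq]
  field_simp
  ring

/-- `u = (1 + √d y) / x`. -/
lemma u_eq : (RatFunc.X : RatFunc kbar) =
    (1 + algebraMap kbar (RatFunc kbar) S.sqrtD * S.yE) / S.xE := by
  have h0 : (RatFunc.X : RatFunc kbar) ≠ 0 := RatFunc.X_ne_zero
  have h1 := S.X_sq_add_ne_zero
  have h2 := S.algebraMap_sqrtD_ne_zero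
  have h5 : (2 : RatFunc kbar) ≠ 0 := by
    rw [← map_ofNat (algebraMap kbar (RatFunc kbar)) 2]
    simpa using S.two_ne_zero
  rw [xE, yE, mul_div_cancel₀ _ h2, X_add_eq]
  field_simp
  ring

/-- The endomorphism of `kbar(u)` which is `σ` on `kbar` and sends `u` to `c / u`. -/
def sHom : RatFunc kbar →+* RatFunc kbar :=
  subst (S.σ : kbar →+* kbar) (algebraMap kbar (RatFunc kbar) (algebraMap k kbar S.c) / RatFunc.X)
    (transcendental_div_X (by simpa using S.c_ne_zero))

lemma sHom_algebraMap (a : kbar) :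
    S.sHom (algebraMap kbar (RatFunc kbar) a) = algebraMap kbar (RatFunc kbar) (S.σ a) :=
  subst_algebraMap _ _ _ _

lemma sHom_algebraMap' (a : k) :
    S.sHom (algebraMap k (RatFunc kbar) a) = algebraMap k (RatFunc kbar) a := by
  rw [IsScalarTower.algebraMap_apply k kbar (RatFunc kbar), sHom_algebraMap, AlgEquiv.commutes]

lemma sHom_X : S.sHom RatFunc.X = algebraMap k (RatFunc kbar) S.c / RatFunc.X := by
  rw [sHom, subst_X, ← IsScalarTower.algebraMap_apply]

lemma sHom_xE : S.sHom S.xE = S.xE := by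
  have h0 : (RatFunc.X : RatFunc kbar) ≠ 0 := RatFunc.X_ne_zero
  have hc : algebraMap k (RatFunc kbar) S.c ≠ 0 := by simpa using S.c_ne_zero
  simp only [xE, map_div₀, map_add, sHom_X, sHom_algebraMap', map_ofNat]
  rw [div_div_cancel₀ hc, add_comm]

lemma sHom_yE : S.sHom S.yE = S.yE := by
  have h0 : (RatFunc.X : RatFunc kbar) ≠ 0 := RatFunc.X_ne_zero
  have h1 := S.X_sq_add_ne_zero
  have h2 := S.algebraMap_sqrtD_ne_zero
  have hc : algebraMap k (RatFunc kbar) S.c ≠ 0 := by simpa using S.c_ne_zero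
  simp only [yE, map_div₀, map_sub, map_mul, map_add, sHom_X, sHom_algebraMap', map_ofNat,
    sHom_algebraMap, σ_sqrtD, map_neg, map_one]
  rw [div_div_cancel₀ hc, add_comm (_ / _) RatFunc.X, X_add_eq]
  field_simp
  ring

lemma sHom_surjective : Function.Surjective S.sHom := by
  have hcst : ∀ a : kbar, algebraMap kbar (RatFunc kbar) a ∈ S.sHom.fieldRange := fun a =>
    ⟨algebraMap kbar (RatFunc kbar) (S.σ.symm a), by
      rw [sHom_algebraMap, AlgEquiv.apply_symm_apply]⟩
  have hX : RatFunc.X ∈ S.sHom.fieldRange := by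
    have hc : algebraMap k (RatFunc kbar) S.c ≠ 0 := by simpa using S.c_ne_zero
    exact ⟨algebraMap k (RatFunc kbar) S.c / RatFunc.X, by
      rw [map_div₀, sHom_X, sHom_algebraMap', div_div_cancel₀ hc]⟩
  have hpol : ∀ p : kbar[X], algebraMap kbar[X] (RatFunc kbar) p ∈ S.sHom.fieldRange := by
    intro p
    induction p using Polynomial.induction_on' with
    | add p q hp hq => rw [map_add]; exact add_mem hp hq
    | monomial n a =>
      rw [← Polynomial.C_mul_X_pow_eq_monomial, map_mul, map_pow, RatFunc.algebraMap_X,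
        ← Polynomial.algebraMap_eq, ← IsScalarTower.algebraMap_apply]
      exact mul_mem (hcst a) (pow_mem hX n)
  intro z
  rw [← RingHom.mem_fieldRange, ← RatFunc.num_div_denom z]
  exact div_mem (hpol _) (hpol _)

/-- The automorphism `s` of `kbar(u)` over `E` which restricts to `σ` on `kbar`. -/
def s : RatFunc kbar ≃ₐ[S.E] RatFunc kbar :=
  { RingEquiv.ofBijective S.sHom ⟨S.sHom.injective, S.sHom_surjective⟩ with
    commutes' := by
      rintro ⟨z, hz⟩
      change S.sHom z = z
      induction hz using IntermediateField.adjoin_induction with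
      | mem x hx =>
        rcases hx with rfl | hx
        · exact S.sHom_xE
        · rw [Set.mem_singleton_iff] at hx
          rw [hx, sHom_yE]
      | algebraMap x => exact S.sHom_algebraMap' x
      | add x y _ _ hx hy => rw [map_add, hx, hy]
      | inv x _ hx => rw [map_inv₀, hx]
      | mul x y _ _ hx hy => rw [map_mul, hx, hy] }

lemma s_apply (z : RatFunc kbar) : S.s z = S.sHom z := rfl

/-! #### The modules `kbar^*` and `kbar(u)^*` and the Brauer groups of `l` and `l(u)` -/

/-- The action of a Galois element on `kbar(u)` through the coefficients, fixing `u`. -/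
def coeffHom (g : Gal(kbar/k)) : RatFunc kbar →+* RatFunc kbar :=
  subst (g : kbar →+* kbar) RatFunc.X RatFunc.transcendental_X

lemma coeffHom_algebraMap (g : Gal(kbar/k)) (a : kbar) :
    coeffHom g (algebraMap kbar (RatFunc kbar) a) = algebraMap kbar (RatFunc kbar) (g a) :=
  subst_algebraMap _ _ _ _

lemma coeffHom_X (g : Gal(kbar/k)) : coeffHom g (RatFunc.X : RatFunc kbar) = RatFunc.X :=
  subst_X _ _ _

/-- The `G_l`-module `kbar^*`. -/
def constRep : Representation ℤ S.Gl (Additive kbarˣ) where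
  toFun g := (MonoidHom.toAdditive (Units.map (g.1 : kbar →* kbar))).toIntLinearMap
  map_one' := by ext; rfl
  map_mul' g h := by ext; rfl

lemma coeffHom_one : coeffHom (1 : Gal(kbar/k)) = RingHom.id (RatFunc kbar) :=
  ratFunc_hom_ext (fun a => by rw [coeffHom_algebraMap]; rfl) (by rw [coeffHom_X]; rfl)

lemma coeffHom_mul (g h : Gal(kbar/k)) :
    coeffHom (g * h) = (coeffHom g).comp (coeffHom h : RatFunc kbar →+* RatFunc kbar) :=
  ratFunc_hom_ext (fun a => by simp only [RingHom.comp_apply, coeffHom_algebraMap]; rfl)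
    (by simp only [RingHom.comp_apply, coeffHom_X])

/-- The `G_l`-module `kbar(u)^*`. -/
def funcRep : Representation ℤ S.Gl (Additive (RatFunc kbar)ˣ) where
  toFun g := (MonoidHom.toAdditive
    (Units.map (coeffHom g.1 : RatFunc kbar →* RatFunc kbar))).toIntLinearMap
  map_one' := by
    ext z
    exact RingHom.congr_fun coeffHom_one _
  map_mul' g h := by
    ext z
    exact RingHom.congr_fun (coeffHom_mul g.1 h.1) _

/-- `Br(l) = H²(G_l, kbar^*)`. -/
abbrev BrL : Type _ := H2 S.constRep

/-- `Br(l(u)) = H²(G_l, kbar(u)^*)`. -/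
abbrev BrLu : Type _ := H2 S.funcRep

lemma sHom_comp_coeffHom (g : S.Gl) :
    S.sHom.comp (coeffHom (S.conj g).1) = (coeffHom g.1).comp S.sHom := by
  refine ratFunc_hom_ext (fun a => ?_) ?_
  · simp only [RingHom.comp_apply, coeffHom_algebraMap, sHom_algebraMap]
    congr 1
    exact S.σ.apply_symm_apply (g.1 (S.σ a))
  · simp only [RingHom.comp_apply, coeffHom_X, sHom_X, map_div₀]
    rw [IsScalarTower.algebraMap_apply k kbar (RatFunc kbar), coeffHom_algebraMap,
      AlgEquiv.commutes]

/-- The natural action `s^*` on `Br(l(u))`, induced by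
`h ↦ ((g₁, g₂) ↦ s (h (σ⁻¹ g₁ σ, σ⁻¹ g₂ σ)))`. -/
def sStar : S.BrLu →+ S.BrLu :=
  H2.map (ρ := S.funcRep) (ρ' := S.funcRep) S.conj S.continuous_conj
    (MonoidHom.toAdditive (Units.map (S.s : RatFunc kbar →* RatFunc kbar))) (fun g z => by
      apply Additive.toMul.injective
      ext
      exact RingHom.congr_fun (S.sHom_comp_coeffHom g) _)

/-! #### The summands of `Br(l(u))` -/

/-- `Br(l) → Br(l(u))`, induced by `kbar^* ⊆ kbar(u)^*`. -/
def inclBr : S.BrL →+ S.BrLu :=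
  H2.map (ρ := S.constRep) (ρ' := S.funcRep) (MonoidHom.id _) continuous_id
    (MonoidHom.toAdditive
      (Units.map (algebraMap kbar (RatFunc kbar) : kbar →* RatFunc kbar))) (fun g z => by
      apply Additive.toMul.injective
      ext
      exact (coeffHom_algebraMap g.1 _).symm)

/-- The rational function `u`, as a unit. -/
def uUnit : (RatFunc kbar)ˣ := Units.mk0 RatFunc.X RatFunc.X_ne_zero

/-- `X(l) → Br(l(u))`: the composition of `δ : H¹(G_l, ℚ/ℤ) → H²(G_l, ℤ)` with the map induced
by `π : ℤ → ⟨u⟩ ⊆ kbar(u)^*`, `π e = u ^ e`. -/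
def inclU : Character S.Gl →+ S.BrLu :=
  (H2.map (ρ := Representation.trivial ℤ S.Gl ℤ) (ρ' := S.funcRep) (MonoidHom.id _) continuous_id
    (AddMonoidHom.mk' (fun e : ℤ => Additive.ofMul (uUnit ^ e)) fun e e' => by
      rw [zpow_add]; rfl) (fun g e => by
      apply Additive.toMul.injective
      ext
      change (uUnit ^ e : (RatFunc kbar)ˣ).1 = coeffHom g.1 (uUnit ^ e : (RatFunc kbar)ˣ).1
      simp [uUnit, coeffHom_X])).comp delta

/-- The index set of the decomposition: the monic irreducible polynomials `p ≠ u` in `l[u]`. -/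
def Place : Type _ := {p : Polynomial S.l // p.Monic ∧ Irreducible p ∧ p ≠ Polynomial.X}

instance : DecidableEq S.Place := Classical.decEq _

/-- The absolute Galois group of `l(a)`, as a subgroup of `G_l`. -/
def Ga (a : kbar) : Subgroup S.Gl := (S.l ⊔ k⟮a⟯).fixingSubgroup.subgroupOf S.Gl

/-- The rational function `u - b`, as a unit. -/
def uSub (b : kbar) : (RatFunc kbar)ˣ :=
  Units.mk0 (RatFunc.X - algebraMap kbar (RatFunc kbar) b) fun h =>
    RatFunc.transcendental_X (K := kbar) (by
      rw [sub_eq_zero.mp h]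
      exact isAlgebraic_algebraMap b)

lemma apply_of_mem_Ga {a : kbar} {g : S.Gl} (hg : g ∈ S.Ga a) : g.1 a = a := by
  rw [Ga, Subgroup.mem_subgroupOf, IntermediateField.mem_fixingSubgroup_iff] at hg
  exact hg a ((le_sup_right : k⟮a⟯ ≤ S.l ⊔ k⟮a⟯) (IntermediateField.mem_adjoin_simple_self k a))

/-- The factor belonging to a coset does not depend on the representative. -/
lemma iota_factor (a : kbar)
    (x : Representation.coindV (S.Ga a).subtype (Representation.trivial ℤ (S.Ga a) ℤ))
    (τ : S.Gl) : uSub (((τ : S.Gl ⧸ S.Ga a).out).1 a) ^ x.1 ((τ : S.Gl ⧸ S.Ga a).out)⁻¹ =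
      uSub (τ.1 a) ^ x.1 τ⁻¹ := by
  obtain ⟨h, hh⟩ := QuotientGroup.mk_out_eq_mul (S.Ga a) τ
  rw [hh, mul_inv_rev, ← Subgroup.coe_inv, coindV_mul, Subgroup.coe_mul, AlgEquiv.mul_apply,
    S.apply_of_mem_Ga h.2]

lemma map_uSub (g : Gal(kbar/k)) (b : kbar) :
    Units.map (coeffHom g : RatFunc kbar →* RatFunc kbar) (uSub b) = uSub (g b) := by
  ext
  change coeffHom g (RatFunc.X - algebraMap kbar (RatFunc kbar) b) = _
  rw [map_sub, coeffHom_X, coeffHom_algebraMap]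
  rfl

variable [IsAlgClosure k kbar]

lemma isOpen_fixing (a : kbar) :
    IsOpen (((S.l ⊔ k⟮a⟯).fixingSubgroup : Subgroup Gal(kbar/k)) : Set Gal(kbar/k)) := by
  have : FiniteDimensional k k⟮a⟯ :=
    IntermediateField.adjoin.finiteDimensional (Algebra.IsIntegral.isIntegral a)
  have : FiniteDimensional k S.l :=
    IntermediateField.adjoin.finiteDimensional (Algebra.IsIntegral.isIntegral S.sqrtD)
  exact IntermediateField.fixingSubgroup_isOpen _

lemma isOpen_Ga (a : kbar) : IsOpen (S.Ga a : Set S.Gl) :=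
  (S.isOpen_fixing a).preimage continuous_subtype_val

variable [PerfectField k]

instance finiteIndex_Ga (a : kbar) : (S.Ga a).FiniteIndex := by
  have : IsGalois k kbar := {}
  have h : Finite (Gal(kbar/k) ⧸ (S.l ⊔ k⟮a⟯).fixingSubgroup) :=
    Subgroup.quotient_finite_of_isOpen _ (S.isOpen_fixing a)
  have := Subgroup.finiteIndex_of_finite_quotient (H := (S.l ⊔ k⟮a⟯).fixingSubgroup)
  unfold Ga
  infer_instance

/-- The homomorphism `ι : Ind ℤ → kbar(u)^*`,
`ι x = ∏_{τ H ∈ G_l / H} (u - τ a) ^ x (τ⁻¹)`, for `H` the absolute Galois group of `l(a)`.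
If `p` is the minimal polynomial of `a` over `l`, it maps `Ind ℤ` isomorphically onto the subgroup
of `kbar(u)^*` generated by the `u - b`, `b` a root of `p`. -/
def iota (a : kbar) :
    Representation.coindV (S.Ga a).subtype (Representation.trivial ℤ (S.Ga a) ℤ) →+
      Additive (RatFunc kbar)ˣ where
  toFun x := Additive.ofMul (∏ᶠ q : S.Gl ⧸ S.Ga a, uSub (q.out.1 a) ^ x.1 q.out⁻¹)
  map_zero' := by simp
  map_add' x y := by
    rw [← ofMul_mul, ← finprod_mul_distrib (Set.toFinite _) (Set.toFinite _)]
    simp [zpow_add]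

lemma iota_equivariant (a : kbar) (g : S.Gl)
    (x : Representation.coindV (S.Ga a).subtype (Representation.trivial ℤ (S.Ga a) ℤ)) :
    S.iota a (indZ (S.Ga a) g x) = S.funcRep g (S.iota a x) := by
  apply Additive.toMul.injective
  change (∏ᶠ q : S.Gl ⧸ S.Ga a, uSub (q.out.1 a) ^ x.1 (q.out⁻¹ * g)) =
    Units.map (coeffHom g.1 : RatFunc kbar →* RatFunc kbar)
      (∏ᶠ q : S.Gl ⧸ S.Ga a, uSub (q.out.1 a) ^ x.1 q.out⁻¹)
  rw [MonoidHom.map_finprod _ (Set.toFinite _)]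
  refine (finprod_eq_of_bijective (fun q => g • q) (MulAction.bijective g) fun q => ?_).symm
  have h := S.iota_factor a (indZ (S.Ga a) g x) (g * q.out)
  have hq : ((g * q.out : S.Gl) : S.Gl ⧸ S.Ga a) = g • q := by
    conv_rhs => rw [← QuotientGroup.out_eq' q]
    rfl
  rw [hq, indZ_apply, indZ_apply] at h
  rw [h, map_zpow, map_uSub, mul_inv_rev, inv_mul_cancel_right]
  rfl

/-- `X(l(a)) → Br(l(u))`: the composition `ι^* ∘ sh ∘ δ`. -/
def inclA (a : kbar) : Character (S.Ga a) →+ S.BrLu :=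
  ((H2.map (ρ := indZ (S.Ga a)) (ρ' := S.funcRep) (MonoidHom.id _) continuous_id
    (S.iota a) (S.iota_equivariant a)).comp (shapiro (S.Ga a) (S.isOpen_Ga a))).comp delta

/-- The Auslander–Brumer–Faddeev map
`Br(l) ⊕ X(l) ⊕ (⨁_p X(l(a_p))) → Br(l(u))` for a choice of a root `a_p` of each `p`. -/
def decomp (a : S.Place → kbar) :
    S.BrL × Character S.Gl × (⨁ p, Character (S.Ga (a p))) →+ S.BrLu :=
  S.inclBr.coprod (S.inclU.coprod (DirectSum.toAddMonoid fun p => S.inclA (a p)))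

/-- `Cor : X(l(a)) → X(l)`. -/
def corA (a : kbar) : Character (S.Ga a) →+ Character S.Gl := cor (S.isOpen_Ga a)

end ConicData

end GenusZero

end

open scoped DirectSum

noncomputable section

namespace GenusZero

/-! ### Cochain computations in continuous H² and the connecting homomorphism -/

section Cohomology

variable {G G' G'' M M' M'' : Type*} [Group G] [TopologicalSpace G] [Group G']
  [TopologicalSpace G'] [Group G''] [TopologicalSpace G'']
  [AddCommGroup M] [AddCommGroup M'] [AddCommGroup M'']
  {ρ : Representation ℤ G M} {ρ' : Representation ℤ G' M'} {ρ'' : Representation ℤ G'' M''}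

/-! Everything rests on one identity of rational functions. Since `s` is `σ` on constants and sends
`u` to `c/u`, for `b ≠ 0` s(u - b) = (-σ b) · u⁻¹ · (u - c/σ b) (`sHom_uSub`). Multiplying over the
conjugates `τ a` of a root `a` with exponents `x(τ⁻¹)` splits `s ∘ ι` into three factors
(`sUnits_iota`): a constant; `u` to the power minus the degree `∑ x(τ⁻¹)`; and the map `ι` belonging
to the root `b` chosen for the minimal polynomial of `c/σ a`, composed with an isomorphism of
induced modules.

Each factor is equivariant along `g ↦ σ⁻¹ g σ`, so the splitting passes to H². The constant factor
lands in `Br(l)`. The last factor lands in the summand `X(l(b))`, because Shapiro's map is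
compatible with conjugation (`map_conjInd_shapiro_delta`). The middle factor lands in `X(l)`: the
degree map on the induced module turns Shapiro's map into corestriction
(`map_coindDegree_shapiro_delta`), conjugation contributes `σ`, and the exponent -1 of `u`
contributes the sign. This exhibits one decomposition of `s^*(Φ(χ))` with `X(l)`-component `-σ(Cor
χ)` (`sStar_inclA`).

For uniqueness of that component, bijectivity of `Φ` is not needed. The order of vanishing at `u =
0` induces `Br(l(u)) → H²(G_l, ℤ)`, which kills `Br(l)` and every `X(l(a_p))`, since constants and
the `u - τ a_p` are units at `0`, and which is `δ` on `X(l)` (`ramZero_decomp`). Finally `δ` is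
injective because the compact group `G_l` has no nonzero continuous homomorphism to discrete `ℚ`
(`delta_injective`). -/

lemma H2.mk_surjective : Function.Surjective (H2.mk ρ) := QuotientAddGroup.mk_surjective

lemma H2.mk_eq_mk_iff {f f' : Z2 ρ} : H2.mk ρ f = H2.mk ρ f' ↔
    ∃ b : G → M, IsLocallyConstant b ∧
      ∀ g h, f.1 (g, h) - f'.1 (g, h) = ρ g (b h) - b (g * h) + b g := by
  rw [← sub_eq_zero, ← map_sub]
  exact QuotientAddGroup.eq_zero_iff (N := B2 ρ) (f - f')

lemma H2.map_mk (c : G' →* G) (hc : Continuous c) (φ : M →+ M')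
    (hφ : ∀ g m, φ (ρ (c g) m) = ρ' g (φ m)) (f : Z2 ρ) :
    H2.map c hc φ hφ (H2.mk ρ f) = H2.mk ρ' (Z2.map c hc φ hφ f) := rfl

lemma Z2.map_apply (c : G' →* G) (hc : Continuous c) (φ : M →+ M')
    (hφ : ∀ g m, φ (ρ (c g) m) = ρ' g (φ m)) (f : Z2 ρ) (q : G' × G') :
    (Z2.map (ρ' := ρ') c hc φ hφ f).1 q = φ (f.1 (c q.1, c q.2)) := rfl

lemma H2.map_map (c : G' →* G) (hc : Continuous c) (φ : M →+ M')
    (hφ : ∀ g m, φ (ρ (c g) m) = ρ' g (φ m)) (c' : G'' →* G') (hc' : Continuous c')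
    (φ' : M' →+ M'') (hφ' : ∀ g m, φ' (ρ' (c' g) m) = ρ'' g (φ' m)) (x : H2 ρ) :
    H2.map c' hc' φ' hφ' (H2.map c hc φ hφ x) =
      H2.map (c.comp c') (hc.comp hc') (φ'.comp φ)
        (fun g m => by simp only [MonoidHom.comp_apply, AddMonoidHom.comp_apply, hφ, hφ']) x := by
  obtain ⟨f, rfl⟩ := H2.mk_surjective x
  rfl

lemma H2.map_zero_hom (c : G' →* G) (hc : Continuous c) (φ : M →+ M')
    (hφ : ∀ g m, φ (ρ (c g) m) = ρ' g (φ m)) (h0 : φ = 0) (x : H2 ρ) :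
    H2.map c hc φ hφ x = 0 := by
  subst h0
  obtain ⟨f, rfl⟩ := H2.mk_surjective x
  rw [H2.map_mk, ← map_zero (H2.mk ρ')]
  rfl

lemma delta_apply (χ : Character G) : delta χ = H2.mk _ (deltaCocycle χ) := rfl

lemma deltaCocycle_apply (χ : Character G) (g h : G) : (((deltaCocycle χ).1 (g, h) : ℤ) : ℚ) =
    (χ.1 h).out - (χ.1 (g * h)).out + (χ.1 g).out :=
  floor_of_mk_eq_zero (delta_mk χ g h)

lemma Character.comap_apply (c : G' →* G) (hc : Continuous c) (χ : Character G) (g : G') :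
    (Character.comap c hc χ).1 g = χ.1 (c g) := rfl

/-- `δ` is compatible with pullback. -/
lemma delta_comap (c : G' →* G) (hc : Continuous c) (χ : Character G) :
    delta (Character.comap c hc χ) =
      H2.map (ρ := Representation.trivial ℤ G ℤ) (ρ' := Representation.trivial ℤ G' ℤ) c hc
        (AddMonoidHom.id ℤ) (by simp) (delta χ) := by
  rw [delta_apply, delta_apply, H2.map_mk]
  congr 1
  ext ⟨g, h⟩
  simp only [deltaCocycle, Z2.map_apply, AddMonoidHom.id_apply, Character.comap_apply, map_mul]

/-- A criterion for computing `δ`: any rational lift of a character may be used. -/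
lemma mk_eq_delta_of_lift (f : Z2 (Representation.trivial ℤ G ℤ)) (χ : Character G) (b : G → ℚ)
    (hb : IsLocallyConstant b) (hχ : ∀ g, (b g : QmodZ) = χ.1 g)
    (hf : ∀ g h, ((f.1 (g, h) : ℤ) : ℚ) = b h - b (g * h) + b g) : H2.mk _ f = delta χ := by
  rw [delta_apply, H2.mk_eq_mk_iff]
  -- Two rational lifts of `χ` differ by an integral cochain, and its coboundary is the difference
  -- of the cocycles. The floor only turns that integral rational into an integer.
  refine ⟨fun g => ⌊b g - (χ.1 g).out⌋,
    (hb.prodMk χ.2.1).comp (fun x : ℚ × QmodZ => ⌊x.1 - x.2.out⌋), fun g h => ?_⟩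
  have key : ∀ g, ((⌊b g - (χ.1 g).out⌋ : ℤ) : ℚ) = b g - (χ.1 g).out := fun g =>
    floor_of_mk_eq_zero (by rw [QuotientAddGroup.mk_sub, mk_out, hχ, sub_self])
  rw [← Int.cast_inj (α := ℚ)]
  simp only [Representation.trivial_apply, Int.cast_sub, Int.cast_add, key, hf,
    deltaCocycle_apply]
  ring

/-- A compact group has no nonzero continuous homomorphisms to the discrete group `ℚ`. -/
lemma eq_zero_of_isLocallyConstant_hom [CompactSpace G] (b : G → ℚ) (hb : IsLocallyConstant b)
    (hadd : ∀ g h, b (g * h) = b g + b h) : b = 0 := by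
  -- Starting at exponent 1 avoids a separate proof of `b 1 = 0`.
  have hpow : ∀ (g : G) (n : ℕ), b (g ^ (n + 1)) = (n + 1 : ℕ) * b g := by
    intro g n
    induction n with
    | zero => simp
    | succ n ih => rw [pow_succ, hadd, ih]; push_cast; ring
  by_contra hne
  obtain ⟨g, hg⟩ : ∃ g, b g ≠ 0 := by
    by_contra! h
    exact hne (funext h)
  -- The multiples of a nonzero `b g` are infinitely many values, but a locally constant map on a
  -- compact space takes only finitely many.
  refine Set.infinite_range_of_injective (f := fun n : ℕ => b (g ^ (n + 1))) ?_
    (hb.range_finite.subset ?_)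
  · intro m n hmn
    simp only [hpow] at hmn
    have := mul_right_cancel₀ hg hmn
    exact_mod_cast (add_left_injective 1 (by exact_mod_cast this) : m = n)
  · rintro _ ⟨n, rfl⟩
    exact ⟨_, rfl⟩

/-- If the cocycle of `χ` is the coboundary of an integral cochain `b`, then the rational lift of
`χ` minus `b` is a continuous homomorphism to `ℚ`. By compactness it vanishes, so the lift is
integral and `χ = 0`. -/
lemma delta_injective [CompactSpace G] : Function.Injective (delta (G := G)) := by
  rw [injective_iff_map_eq_zero]
  intro χ hχ
  rw [delta_apply, ← map_zero (H2.mk _), H2.mk_eq_mk_iff] at hχ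
  obtain ⟨b, hb, h⟩ := hχ
  have h0 := eq_zero_of_isLocallyConstant_hom (fun g => ((χ.1 g).out - b g : ℚ))
    ((χ.2.1.prodMk hb).comp fun x : QmodZ × ℤ => (x.1.out - x.2 : ℚ)) (fun g g' => by
      have h1 := congrArg (Int.cast (R := ℚ)) (h g g')
      have h2 := deltaCocycle_apply χ g g'
      simp only [ZeroMemClass.coe_zero, Pi.zero_apply, sub_zero,
        Representation.trivial_apply, Int.cast_add, Int.cast_sub] at h1
      rw [h2] at h1
      linarith)
  ext g
  have h1 : ((χ.1 g).out : ℚ) = b g := sub_eq_zero.mp (congrFun h0 g)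
  rw [← mk_out (χ.1 g), h1]
  exact (QuotientAddGroup.eq_zero_iff _).mpr ⟨b g, by simp⟩

end Cohomology

/-! ### Induced modules: degree, Shapiro's map and corestriction -/

section OpenSubgroup

variable {G : Type*} [Group G] (H : Subgroup G)

/-- Left `H`-invariance of `x` makes `τ ↦ x(τ⁻¹)` a function on `G/H`; this permits passing between
`Quotient.out`, `cosetRep` and translated representatives. -/
lemma coindV_inv_eq (x : Representation.coindV H.subtype (Representation.trivial ℤ H ℤ))
    {τ τ' : G} (h : (τ : G ⧸ H) = τ') : x.1 τ⁻¹ = x.1 τ'⁻¹ := by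
  have := coindV_mul H x ⟨τ⁻¹ * τ', QuotientGroup.eq.mp h⟩ τ'⁻¹
  simpa using this

variable [H.FiniteIndex]

/-- The `G`-invariant map `Ind_G^H ℤ → ℤ`, `x ↦ ∑_{τ H} x (τ⁻¹)`. -/
def coindDegree :
    Representation.coindV H.subtype (Representation.trivial ℤ H ℤ) →+ ℤ where
  toFun x := ∑ᶠ q : G ⧸ H, x.1 q.out⁻¹
  map_zero' := by simp
  map_add' x y := by
    rw [← finsum_add_distrib (Set.toFinite _) (Set.toFinite _)]
    simp

lemma coindDegree_apply (x : Representation.coindV H.subtype (Representation.trivial ℤ H ℤ)) :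
    coindDegree H x = ∑ᶠ q : G ⧸ H, x.1 q.out⁻¹ := rfl

/-- The degree may be computed with any representatives, and is `G`-invariant. -/
lemma coindDegree_indZ (g : G)
    (x : Representation.coindV H.subtype (Representation.trivial ℤ H ℤ)) :
    coindDegree H (indZ H g x) = coindDegree H x := by
  rw [coindDegree_apply, coindDegree_apply]
  refine finsum_eq_of_bijective (fun q => g⁻¹ • q) (MulAction.bijective g⁻¹) fun q => ?_
  rw [indZ_apply]
  have : q.out⁻¹ * g = (g⁻¹ * q.out)⁻¹ := by group
  rw [this]
  refine coindV_inv_eq H x ?_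
  rw [QuotientGroup.out_eq']
  conv_rhs => rw [← QuotientGroup.out_eq' q]
  rfl

lemma coindDegree_equivariant (g : G)
    (x : Representation.coindV H.subtype (Representation.trivial ℤ H ℤ)) :
    coindDegree H (indZ H (MonoidHom.id G g) x) =
      Representation.trivial ℤ G ℤ g (coindDegree H x) :=
  coindDegree_indZ H g x

variable [TopologicalSpace G] [IsTopologicalGroup G]

lemma shapiro_mk (hH : IsOpen (H : Set G)) (f : Z2 (Representation.trivial ℤ H ℤ)) :
    shapiro H hH (H2.mk _ f) = H2.mk _ (shapiroCocycle H hH f) := rfl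

lemma shapiroCocycle_apply (hH : IsOpen (H : Set G)) (f : Z2 (Representation.trivial ℤ H ℤ))
    (g h g₀ : G) : ((shapiroCocycle H hH f).1 (g, h)).1 g₀ =
      f.1 ((retr H g₀)⁻¹ * retr H (g₀ * g), (retr H (g₀ * g))⁻¹ * retr H (g₀ * g * h)) := rfl

/-- Shapiro's map may be computed with any continuous left `H`-equivariant map `r : G → H`. -/
lemma mk_eq_shapiro_of_retraction (hH : IsOpen (H : Set G)) (r : G → H) (hrc : Continuous r)
    (hr : ∀ (h : H) (g : G), r (h * g) = h * r g) (f : Z2 (Representation.trivial ℤ H ℤ))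
    (F : Z2 (indZ H)) (hF : ∀ g h g₀, (F.1 (g, h)).1 g₀ =
      f.1 ((r g₀)⁻¹ * r (g₀ * g), (r (g₀ * g))⁻¹ * r (g₀ * g * h))) :
    H2.mk _ F = shapiro H hH (H2.mk _ f) := by
  rw [shapiro_mk, H2.mk_eq_mk_iff]
  have hc := continuous_retr H hH
  -- The homogeneous form of `f`, in which changing the retraction is the usual prism homotopy.
  let φ : H → H → H → ℤ := fun x y z => f.1 (x⁻¹ * y, y⁻¹ * z)
  have hφ : ∀ x y z w, φ y z w - φ x z w + φ x y w - φ x y z = 0 := fun x y z w => by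
    have := f.2.2 (x⁻¹ * y) (y⁻¹ * z) (z⁻¹ * w)
    simpa [φ, mul_assoc] using this
  have hφc : ∀ a b c : G → H, Continuous a → Continuous b → Continuous c →
      IsLocallyConstant fun g => φ (a g) (b g) (c g) := fun a b c ha hb hc =>
    f.2.1.comp_continuous ((ha.inv.mul hb).prodMk (hb.inv.mul hc))
  have hφm : ∀ h x y z, φ (h * x) (h * y) (h * z) = φ x y z := fun h x y z => by
    simp [φ, mul_assoc]
  -- The square with edges `(r g₀, r (g₀ g))` and `(retr g₀, retr (g₀ g))`, cut into two triangles.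
  refine ⟨fun g => ⟨fun g₀ => φ (r g₀) (r (g₀ * g)) (retr H (g₀ * g)) -
      φ (r g₀) (retr H g₀) (retr H (g₀ * g)), fun h g₀ => by
        simp only [Subgroup.subtype_apply, mul_assoc, retr_mul, hr, hφm,
          Representation.trivial_apply]⟩,
      isLocallyConstant_coindV H _ fun g₀ => ?_, fun g h => ?_⟩
  · exact (hφc _ _ _ (by fun_prop) (by fun_prop) (by fun_prop)).sub
      (hφc _ _ _ (by fun_prop) (by fun_prop) (by fun_prop))
  · ext g₀
    simp only [Submodule.coe_add, Submodule.coe_sub, Pi.add_apply, Pi.sub_apply, indZ_apply]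
    rw [hF, shapiroCocycle_apply]
    change φ (r g₀) (r (g₀ * g)) (r (g₀ * g * h)) -
      φ (retr H g₀) (retr H (g₀ * g)) (retr H (g₀ * g * h)) = _
    rw [← mul_assoc]
    -- The cocycle identity on the three tetrahedra of the prism over the triangle `g₀, g₀ g, g₀ g
    -- h`.
    linear_combination
      hφ (r g₀) (r (g₀ * g)) (retr H (g₀ * g)) (retr H (g₀ * g * h)) -
      hφ (r g₀) (r (g₀ * g)) (r (g₀ * g * h)) (retr H (g₀ * g * h)) -
      hφ (r g₀) (retr H g₀) (retr H (g₀ * g)) (retr H (g₀ * g * h))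

/-- The corestriction of a character in terms of the retraction `retr`. -/
lemma cor_apply (hH : IsOpen (H : Set G)) (χ : Character H) (g : G) :
    (cor hH χ).1 g = ∑ᶠ q : G ⧸ H,
      χ.1 ((retr H (cosetRep H q)⁻¹)⁻¹ * retr H ((cosetRep H q)⁻¹ * g)) := by
  let := H.fintypeQuotientOfFiniteIndex
  -- The transfer does not depend on the transversal. With the representatives `τ` used by `retr`,
  -- one has `retr τ⁻¹ = 1`, and `retr (τ⁻¹ g)` is exactly the transfer factor `τ⁻¹ g τ'`.
  let T : H.LeftTransversal := ⟨_, Subgroup.isComplement_range_left (mk_cosetRep H)⟩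
  have hT : ∀ q, (T.2.leftQuotientEquiv q : G) = cosetRep H q :=
    Subgroup.IsComplement.leftQuotientEquiv_apply (mk_cosetRep H)
  change (MonoidHom.transfer (toHom χ) g).toAdd = _
  rw [MonoidHom.transfer_def (toHom χ) T, finsum_eq_sum_of_fintype]
  refine Finset.sum_congr rfl fun q _ => ?_
  refine congrArg χ.1 (Subtype.ext ?_)
  simp only [Subgroup.smul_apply_eq_smul_apply_inv_smul, hT, retr, Subgroup.coe_mul,
    Subgroup.coe_inv, mul_inv_rev, inv_inv, mk_cosetRep, smul_eq_mul]
  have : ((g⁻¹ * cosetRep H q : G) : G ⧸ H) = g⁻¹ • q := by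
    conv_rhs => rw [← mk_cosetRep H q]
    rfl
  rw [this]
  group

/-- The map induced by the degree `Ind_G^H ℤ → ℤ` turns `sh ∘ δ` into `δ ∘ cor`. -/
lemma map_coindDegree_shapiro_delta (hH : IsOpen (H : Set G)) (χ : Character H) :
    H2.map (ρ := indZ H) (ρ' := Representation.trivial ℤ G ℤ) (MonoidHom.id G) continuous_id
      (coindDegree H) (coindDegree_equivariant H) (shapiro H hH (delta χ)) = delta (cor hH χ) := by
  let := H.fintypeQuotientOfFiniteIndex
  have hc := continuous_retr H hH
  -- A rational lift of each summand of `cor χ`; the Shapiro cocycle of `δ χ` at `(g, h)`, evaluated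
  -- at `g₀`, is `B (g₀ g) h - B g₀ (g h) + B g₀ g`.
  let B : G → G → ℚ := fun g₀ g => (χ.1 ((retr H g₀)⁻¹ * retr H (g₀ * g))).out
  have hB : ∀ (h : H) g₀ g, B (h * g₀) g = B g₀ g := fun h g₀ g => by
    simp [B, mul_assoc, retr_mul]
  have hB' : ∀ {τ τ' : G} (_ : (τ : G ⧸ H) = τ') (g : G), B τ⁻¹ g = B τ'⁻¹ g := by
    intro τ τ' h g
    simpa using hB ⟨τ⁻¹ * τ', QuotientGroup.eq.mp h⟩ τ'⁻¹ g
  rw [delta_apply χ, shapiro_mk, H2.map_mk]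
  refine mk_eq_delta_of_lift _ _ (fun g => ∑ q : G ⧸ H, B (cosetRep H q)⁻¹ g) ?_ ?_ ?_
  · rw [IsLocallyConstant.iff_eventually_eq]
    intro g
    have h1 : ∀ q : G ⧸ H, IsLocallyConstant fun g => B (cosetRep H q)⁻¹ g := fun q => by
      refine IsLocallyConstant.comp ?_ (fun x : QmodZ => x.out)
      exact χ.2.1.comp_continuous (by fun_prop)
    filter_upwards [Filter.eventually_all.mpr fun q => (h1 q).eventually_eq g] with g' hg'
    exact Finset.sum_congr rfl fun q _ => hg' q
  · intro g
    rw [cor_apply, finsum_eq_sum_of_fintype]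
    change QuotientAddGroup.mk' _ _ = _
    rw [map_sum]
    exact Finset.sum_congr rfl fun q _ => mk_out _
  · intro g h
    rw [Z2.map_apply, coindDegree_apply, finsum_eq_sum_of_fintype]
    -- Translation by `g⁻¹` permutes the cosets. It matches the first term above with that of a
    -- coboundary for the trivial action.
    have h2 : ∑ q : G ⧸ H, B (cosetRep H q)⁻¹ h = ∑ q : G ⧸ H, B ((cosetRep H q)⁻¹ * g) h := by
      refine (Fintype.sum_bijective (fun q => g⁻¹ • q) (MulAction.bijective g⁻¹) _ _
        fun q => ?_).symm
      have : (cosetRep H q)⁻¹ * g = (g⁻¹ * cosetRep H q)⁻¹ := by group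
      rw [this]
      refine hB' ?_ h
      rw [mk_cosetRep]
      conv_rhs => rw [← mk_cosetRep H q]
      rfl
    rw [h2, ← Finset.sum_sub_distrib, ← Finset.sum_add_distrib, Int.cast_sum]
    refine Finset.sum_congr rfl fun q _ => ?_
    rw [coindV_inv_eq H _ ((QuotientGroup.out_eq' q).trans (mk_cosetRep H q).symm)]
    simp only [MonoidHom.id_apply]
    rw [shapiroCocycle_apply, deltaCocycle_apply]
    simp [B, mul_assoc]

end OpenSubgroup

open Polynomial IntermediateField

namespace ConicData

variable {k kbar : Type*} [Field k] [Field kbar] [Algebra k kbar] (S : ConicData k kbar)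

/-! #### The order at `u = 0` -/

lemma coeffHom_polynomial (g : Gal(kbar/k)) (p : kbar[X]) :
    coeffHom g (algebraMap kbar[X] (RatFunc kbar) p) =
      algebraMap kbar[X] (RatFunc kbar) (p.map (g : kbar →+* kbar)) := by
  induction p using Polynomial.induction_on' with
  | add p q hp hq => rw [map_add, map_add, hp, hq, Polynomial.map_add, map_add]
  | monomial n a =>
    rw [Polynomial.map_monomial, ← Polynomial.C_mul_X_pow_eq_monomial,
      ← Polynomial.C_mul_X_pow_eq_monomial, map_mul, map_mul, map_mul, map_pow, map_pow,
      RatFunc.algebraMap_X, coeffHom_X, ← Polynomial.algebraMap_eq,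
      ← IsScalarTower.algebraMap_apply, ← IsScalarTower.algebraMap_apply, coeffHom_algebraMap]
    rfl

lemma intDegree_coeffHom (g : Gal(kbar/k)) (z : RatFunc kbar) :
    (coeffHom g z).intDegree = z.intDegree := by
  by_cases hz : z = 0
  · rw [hz, map_zero]
  have hn : algebraMap kbar[X] (RatFunc kbar) z.num ≠ 0 :=
    RatFunc.algebraMap_ne_zero (RatFunc.num_ne_zero hz)
  have hd : algebraMap kbar[X] (RatFunc kbar) z.denom ≠ 0 :=
    RatFunc.algebraMap_ne_zero z.denom_ne_zero
  conv_lhs => rw [← RatFunc.num_div_denom z]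
  conv_rhs => rw [← RatFunc.num_div_denom z]
  rw [map_div₀, RatFunc.intDegree_div ((_root_.map_ne_zero _).mpr hn) ((_root_.map_ne_zero _).mpr hd),
    RatFunc.intDegree_div hn hd]
  simp only [coeffHom_polynomial, RatFunc.intDegree_polynomial, Polynomial.natDegree_map]

/-- Both sides agree on constants and on `u`, since `c` is fixed by Galois. Writing the relation
with `σ g σ⁻¹` lets the coefficient action be pulled out of `s`, where `intDegree_coeffHom` removes
it. -/
lemma sHom_comp_coeffHom_conj (g : Gal(kbar/k)) :
    S.sHom.comp (coeffHom g) = (coeffHom (S.σ * g * S.σ⁻¹)).comp S.sHom := by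
  refine ratFunc_hom_ext (fun a => ?_) ?_
  · simp only [RingHom.comp_apply, coeffHom_algebraMap, sHom_algebraMap]
    congr 1
    exact congrArg (fun x => S.σ (g x)) (S.σ.symm_apply_apply a).symm
  · simp only [RingHom.comp_apply, coeffHom_X, sHom_X, map_div₀]
    rw [IsScalarTower.algebraMap_apply k kbar (RatFunc kbar), coeffHom_algebraMap,
      AlgEquiv.commutes]

/-- The order of vanishing at `u = 0`, as minus the degree after the substitution `u ↦ c / u`. -/
def ordZero : Additive (RatFunc kbar)ˣ →+ ℤ :=
  AddMonoidHom.mk' (fun z => -(S.sHom (z.toMul : (RatFunc kbar)ˣ)).intDegree) fun z w => by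
    rw [toMul_add, Units.val_mul, map_mul, RatFunc.intDegree_mul
      ((_root_.map_ne_zero _).mpr (Units.ne_zero _)) ((_root_.map_ne_zero _).mpr (Units.ne_zero _)), neg_add]

lemma ordZero_ofMul (z : (RatFunc kbar)ˣ) :
    S.ordZero (Additive.ofMul z) = -(S.sHom (z : RatFunc kbar)).intDegree := rfl

lemma ordZero_equivariant (g : S.Gl) (z : Additive (RatFunc kbar)ˣ) :
    S.ordZero (S.funcRep (MonoidHom.id _ g) z) =
      Representation.trivial ℤ S.Gl ℤ g (S.ordZero z) := by
  change -(S.sHom (coeffHom g.1 (z.toMul : (RatFunc kbar)ˣ))).intDegree = -_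
  rw [← RingHom.comp_apply, sHom_comp_coeffHom_conj, RingHom.comp_apply, intDegree_coeffHom]

lemma intDegree_algebraMap (a : kbar) : (algebraMap kbar (RatFunc kbar) a).intDegree = 0 := by
  rw [RatFunc.algebraMap_eq_C, RatFunc.intDegree_C]

lemma algebraMap_c_ne_zero : algebraMap k kbar S.c ≠ 0 := by simpa using S.c_ne_zero

lemma ordZero_uUnit : S.ordZero (Additive.ofMul uUnit) = 1 := by
  rw [ordZero_ofMul]
  change -(S.sHom RatFunc.X).intDegree = 1
  rw [sHom_X, IsScalarTower.algebraMap_apply k kbar (RatFunc kbar), RatFunc.intDegree_div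
    (by simpa using S.c_ne_zero) RatFunc.X_ne_zero, intDegree_algebraMap, RatFunc.intDegree_X]
  norm_num

/-- How `s` transforms a linear polynomial. -/
lemma sHom_uSub {b : kbar} (hb : b ≠ 0) : S.sHom (uSub b : RatFunc kbar) =
    algebraMap kbar (RatFunc kbar) (-S.σ b) * (RatFunc.X)⁻¹ *
      (uSub (algebraMap k kbar S.c / S.σ b) : RatFunc kbar) := by
  change S.sHom (RatFunc.X - algebraMap kbar (RatFunc kbar) b) = _ * _ *
    (RatFunc.X - algebraMap kbar (RatFunc kbar) _)
  have h0 : (RatFunc.X : RatFunc kbar) ≠ 0 := RatFunc.X_ne_zero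
  have h1 : algebraMap kbar (RatFunc kbar) (S.σ b) ≠ 0 := by simpa using hb
  rw [map_sub, sHom_X, sHom_algebraMap, map_neg, map_div₀,
    IsScalarTower.algebraMap_apply k kbar (RatFunc kbar)]
  field_simp
  ring

/-- In `sHom_uSub` the degrees of the three factors are `0`, `-1` and `1`. -/
lemma ordZero_uSub {b : kbar} (hb : b ≠ 0) : S.ordZero (Additive.ofMul (uSub b)) = 0 := by
  have h1 : algebraMap kbar (RatFunc kbar) (-S.σ b) ≠ 0 := by simpa using hb
  have h2 : ∀ e : kbar, (uSub e : RatFunc kbar).intDegree = 1 := by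
    intro e
    have : (uSub e : RatFunc kbar) = algebraMap kbar[X] (RatFunc kbar) (X - C e) := by
      rw [map_sub, RatFunc.algebraMap_X, ← Polynomial.algebraMap_eq,
        ← IsScalarTower.algebraMap_apply]
      rfl
    rw [this, RatFunc.intDegree_polynomial, Polynomial.natDegree_X_sub_C]
    rfl
  rw [ordZero_ofMul, sHom_uSub S hb, RatFunc.intDegree_mul
    (mul_ne_zero h1 (inv_ne_zero RatFunc.X_ne_zero)) (Units.ne_zero _),
    RatFunc.intDegree_mul h1 (inv_ne_zero RatFunc.X_ne_zero), intDegree_algebraMap,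
    RatFunc.intDegree_inv, RatFunc.intDegree_X, h2]
  norm_num

/-- The map `Br(l(u)) → H²(G_l, ℤ)` induced by the order at `u = 0`. -/
def ramZero : S.BrLu →+ H2 (Representation.trivial ℤ S.Gl ℤ) :=
  H2.map (MonoidHom.id _) continuous_id S.ordZero S.ordZero_equivariant

lemma ramZero_inclBr (β : S.BrL) : S.ramZero (S.inclBr β) = 0 := by
  rw [ramZero, inclBr, H2.map_map]
  refine H2.map_zero_hom _ _ _ _ ?_ _
  ext z
  change -(S.sHom (algebraMap kbar (RatFunc kbar) _)).intDegree = 0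
  rw [sHom_algebraMap, intDegree_algebraMap, neg_zero]

/-- As `u` has order 1 at `0`, the order composed with `e ↦ u ^ e` is the identity of `ℤ`, already
on cocycles. -/
lemma ramZero_inclU (ψ : Character S.Gl) : S.ramZero (S.inclU ψ) = delta ψ := by
  obtain ⟨f, hf⟩ := H2.mk_surjective (delta ψ)
  rw [inclU, AddMonoidHom.comp_apply, ← hf]
  refine congrArg (H2.mk _) (Subtype.ext (funext fun q => ?_))
  change S.ordZero (Additive.ofMul (uUnit ^ f.1 q)) = f.1 q
  rw [ofMul_zpow, map_zsmul, ordZero_uUnit, smul_eq_mul, mul_one]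

/-- A root `0` would make `u` divide `p`, forcing `p = u`, which is excluded from the places. -/
lemma root_ne_zero (p : S.Place) {a : kbar} (ha : aeval a p.1 = 0) : a ≠ 0 := by
  rintro rfl
  obtain ⟨hm, hi, hX⟩ := p.2
  have h0 : p.1.coeff 0 = 0 := by
    rwa [← Polynomial.coeff_zero_eq_aeval_zero', map_eq_zero_iff _
      (algebraMap S.l kbar).injective] at ha
  exact hX (Polynomial.eq_of_monic_of_associated hm Polynomial.monic_X
    (Polynomial.irreducible_X.associated_of_dvd hi (Polynomial.X_dvd_iff.mpr h0)).symm)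

variable [IsAlgClosure k kbar] [PerfectField k]

lemma ramZero_inclA {a : kbar} (ha : a ≠ 0) (χ : Character (S.Ga a)) :
    S.ramZero (S.inclA a χ) = 0 := by
  rw [inclA, AddMonoidHom.comp_apply, AddMonoidHom.comp_apply, ramZero, H2.map_map]
  refine H2.map_zero_hom _ _ _ _ ?_ _
  ext x
  change S.ordZero (Additive.ofMul (∏ᶠ q : S.Gl ⧸ S.Ga a, uSub (q.out.1 a) ^ x.1 q.out⁻¹)) = 0
  let := (S.Ga a).fintypeQuotientOfFiniteIndex
  rw [finprod_eq_prod_of_fintype, ofMul_prod, map_sum]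
  refine Finset.sum_eq_zero fun q _ => ?_
  rw [ofMul_zpow, map_zsmul, ordZero_uSub S (by simpa using ha), smul_zero]

/-- Ramification at `u = 0` reads off the `X(l)`-component of any decomposed class, up to the
injective map `δ`. -/
lemma ramZero_decomp {a : S.Place → kbar} (ha : ∀ p, a p ≠ 0) (β : S.BrL)
    (ψ : Character S.Gl) (ξ : ⨁ p, Character (S.Ga (a p))) :
    S.ramZero (S.decomp a (β, ψ, ξ)) = delta ψ := by
  have h : ∀ ξ : ⨁ p, Character (S.Ga (a p)),
      S.ramZero (DirectSum.toAddMonoid (fun p => S.inclA (a p)) ξ) = 0 := by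
    intro ξ
    induction ξ using DirectSum.induction_on with
    | zero => rw [map_zero, map_zero]
    | of p χ => rw [DirectSum.toAddMonoid_of, S.ramZero_inclA (ha p)]
    | add x y hx hy => rw [map_add, map_add, hx, hy, add_zero]
  rw [decomp, AddMonoidHom.coprod_apply, AddMonoidHom.coprod_apply, map_add, map_add,
    ramZero_inclBr, ramZero_inclU, h, zero_add, add_zero]

/-- A closed subgroup of a profinite group; this is what makes `delta_injective` applicable. -/
instance : CompactSpace S.Gl := by
  have : IsGalois k kbar := {}
  have : FiniteDimensional k S.l :=
    IntermediateField.adjoin.finiteDimensional (Algebra.IsIntegral.isIntegral S.sqrtD)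
  exact isCompact_iff_compactSpace.mp S.l.fixingSubgroup_isClosed.isCompact

end ConicData

namespace ConicData

variable {k kbar : Type*} [Field k] [Field kbar] [Algebra k kbar] (S : ConicData k kbar)

/-! #### Conjugate places

The automorphism `s` maps the zero `a` to the zero `c / σ a`, which is conjugate over `l` to the
chosen root `b` of its minimal polynomial: `b = c / ρ (σ a)` for some `ρ ∈ G_l`. -/

lemma mem_Ga_iff {a : kbar} {g : S.Gl} : g ∈ S.Ga a ↔ g.1 a = a := by
  refine ⟨S.apply_of_mem_Ga, fun h => ?_⟩
  rw [Ga, Subgroup.mem_subgroupOf, IntermediateField.fixingSubgroup_sup]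
  refine ⟨g.2, ?_⟩
  change g.1 ∈ k⟮a⟯.fixingSubgroup
  rw [← Subgroup.zpowers_le, ← IntermediateField.le_iff_le,
    IntermediateField.adjoin_simple_le_iff]
  rintro ⟨_, n, rfl⟩
  exact Subgroup.zpow_mem (MulAction.stabilizer Gal(kbar/k) a) (x := g.1) h n

/-- Normality of `l/k`: every automorphism over `k` sends `√d` to `±√d`, and `g` fixes both. -/
lemma conj_mem_Gl (θ : Gal(kbar/k)) {g : Gal(kbar/k)} (hg : g ∈ S.Gl) : θ * g * θ⁻¹ ∈ S.Gl := by
  have hsq : (θ⁻¹ S.sqrtD) ^ 2 = S.sqrtD ^ 2 := by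
    rw [← map_pow, S.sqrtD_sq, AlgEquiv.commutes]
  have hfix : g (θ⁻¹ S.sqrtD) = θ⁻¹ S.sqrtD := by
    rw [mem_Gl] at hg
    rcases sq_eq_sq_iff_eq_or_eq_neg.mp hsq with h | h <;> simp [h, hg]
  rw [mem_Gl, AlgEquiv.mul_apply, AlgEquiv.mul_apply, hfix]
  exact θ.apply_symm_apply _

lemma conj_surjective : Function.Surjective S.conj := fun g =>
  ⟨⟨S.σ * g.1 * S.σ⁻¹, S.conj_mem_Gl _ g.2⟩, Subtype.ext (by
    change S.σ⁻¹ * (S.σ * g.1 * S.σ⁻¹) * S.σ = g.1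
    group)⟩

lemma σ_conj_apply (g : S.Gl) (a : kbar) : S.σ ((S.conj g).1 a) = g.1 (S.σ a) :=
  S.σ.apply_symm_apply _

variable {S} {a b : kbar} {ρ : S.Gl}

/-- The product of `b` and `ρ σ a` is `c ∈ k`, which `h` fixes, so `h` fixes one factor exactly when
it fixes the other; conjugation by `ρ σ` moves the second condition to `a`. -/
lemma fixes_conj_iff (hab : b * ρ.1 (S.σ a) = algebraMap k kbar S.c) (h : S.Gl) :
    S.conj (ρ⁻¹ * h * ρ) ∈ S.Ga a ↔ h ∈ S.Ga b := by
  have hne : b * ρ.1 (S.σ a) ≠ 0 := by rw [hab]; exact S.algebraMap_c_ne_zero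
  have h1 : h.1 b * h.1 (ρ.1 (S.σ a)) = b * ρ.1 (S.σ a) := by
    rw [← map_mul, hab, AlgEquiv.commutes]
  rw [mem_Ga_iff, mem_Ga_iff, ← S.σ.injective.eq_iff, σ_conj_apply]
  have h2 : (ρ⁻¹ * h * ρ).1 (S.σ a) = S.σ a ↔ h.1 (ρ.1 (S.σ a)) = ρ.1 (S.σ a) :=
    (ρ.1.symm_apply_eq : ρ.1.symm _ = _ ↔ _)
  rw [h2]
  constructor
  · intro h3
    rw [h3] at h1
    exact mul_right_cancel₀ (right_ne_zero_of_mul hne) h1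
  · intro h3
    rw [h3] at h1
    exact mul_left_cancel₀ (left_ne_zero_of_mul hne) h1

/-- Conjugation by `ρ σ` as an isomorphism from the Galois group of `l(b)` to the one of `l(a)`. -/
def conjGa (hab : b * ρ.1 (S.σ a) = algebraMap k kbar S.c) : S.Ga b ≃* S.Ga a where
  toFun h := ⟨S.conj (ρ⁻¹ * h * ρ), (fixes_conj_iff hab _).mpr h.2⟩
  invFun h := ⟨⟨ρ.1 * S.σ * h.1.1 * (ρ.1 * S.σ)⁻¹, S.conj_mem_Gl _ h.1.2⟩, by
    rw [← fixes_conj_iff hab]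
    convert h.2
    ext1
    change S.σ⁻¹ * (ρ.1⁻¹ * (ρ.1 * S.σ * h.1.1 * (ρ.1 * S.σ)⁻¹) * ρ.1) * S.σ = h.1.1
    group⟩
  left_inv h := Subtype.ext <| Subtype.ext <| by
    change ρ.1 * S.σ * (S.σ⁻¹ * (ρ.1⁻¹ * h.1.1 * ρ.1) * S.σ) * (ρ.1 * S.σ)⁻¹ = h.1.1
    group
  right_inv h := Subtype.ext <| Subtype.ext <| by
    change S.σ⁻¹ * (ρ.1⁻¹ * (ρ.1 * S.σ * h.1.1 * (ρ.1 * S.σ)⁻¹) * ρ.1) * S.σ = h.1.1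
    group
  map_mul' g h := Subtype.ext <| by
    change S.conj (ρ⁻¹ * (g * h) * ρ) = S.conj (ρ⁻¹ * g * ρ) * S.conj (ρ⁻¹ * h * ρ)
    rw [← map_mul]
    group

lemma coe_conjGa (hab : b * ρ.1 (S.σ a) = algebraMap k kbar S.c) (h : S.Ga b) :
    (conjGa hab h : S.Gl) = S.conj (ρ⁻¹ * h * ρ) := rfl

/-- The map `g ↦ σ⁻¹ ρ⁻¹ g σ` is left equivariant along `conjGa`. Hence it transports both the
induced module and the retraction from `l(a)` to `l(b)`. -/
lemma conj_inv_mul (hab : b * ρ.1 (S.σ a) = algebraMap k kbar S.c) (h : S.Ga b) (g : S.Gl) :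
    S.conj (ρ⁻¹ * (h * g)) = conjGa hab h * S.conj (ρ⁻¹ * g) := by
  rw [coe_conjGa, ← map_mul]
  group

lemma continuous_conjGa (hab : b * ρ.1 (S.σ a) = algebraMap k kbar S.c) :
    Continuous (conjGa hab).toMonoidHom := by
  refine Continuous.subtype_mk (S.continuous_conj.comp ?_) _
  fun_prop

lemma continuous_conjGa_symm (hab : b * ρ.1 (S.σ a) = algebraMap k kbar S.c) :
    Continuous (conjGa hab).symm := by
  refine Continuous.subtype_mk (Continuous.subtype_mk ?_ _) _
  exact (continuous_const.mul (continuous_subtype_val.comp continuous_subtype_val)).mul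
    continuous_const

/-- The isomorphism of induced modules belonging to `conjGa`. -/
def conjInd (hab : b * ρ.1 (S.σ a) = algebraMap k kbar S.c) :
    Representation.coindV (S.Ga a).subtype (Representation.trivial ℤ (S.Ga a) ℤ) →+
      Representation.coindV (S.Ga b).subtype (Representation.trivial ℤ (S.Ga b) ℤ) where
  toFun x := ⟨fun g => x.1 (S.conj (ρ⁻¹ * g)), fun h g => by
    change x.1 (S.conj (ρ⁻¹ * (h * g))) = x.1 (S.conj (ρ⁻¹ * g))
    rw [conj_inv_mul hab, coindV_mul]⟩
  map_zero' := rfl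
  map_add' _ _ := rfl

lemma conjInd_apply (hab : b * ρ.1 (S.σ a) = algebraMap k kbar S.c)
    (x : Representation.coindV (S.Ga a).subtype (Representation.trivial ℤ (S.Ga a) ℤ))
    (g : S.Gl) : (conjInd hab x).1 g = x.1 (S.conj (ρ⁻¹ * g)) := rfl

lemma conjInd_equivariant (hab : b * ρ.1 (S.σ a) = algebraMap k kbar S.c) (g : S.Gl)
    (x : Representation.coindV (S.Ga a).subtype (Representation.trivial ℤ (S.Ga a) ℤ)) :
    conjInd hab (indZ (S.Ga a) (S.conj g) x) = indZ (S.Ga b) g (conjInd hab x) := by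
  ext g₀
  rw [conjInd_apply, indZ_apply, indZ_apply, conjInd_apply, ← map_mul, mul_assoc]

/-- The bijection `τ ↦ σ⁻¹ τ ρ σ` between the cosets of the Galois groups of `l(b)` and `l(a)`. -/
lemma bijective_conj_coset (hab : b * ρ.1 (S.σ a) = algebraMap k kbar S.c) :
    Function.Bijective fun q : S.Gl ⧸ S.Ga b => ((S.conj (q.out * ρ) : S.Gl) : S.Gl ⧸ S.Ga a) := by
  have key : ∀ τ τ' : S.Gl, ((S.conj (τ * ρ) : S.Gl) : S.Gl ⧸ S.Ga a) = S.conj (τ' * ρ) ↔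
      (τ : S.Gl ⧸ S.Ga b) = τ' := by
    intro τ τ'
    rw [QuotientGroup.eq, QuotientGroup.eq, ← fixes_conj_iff hab, ← map_inv, ← map_mul]
    have : (τ * ρ)⁻¹ * (τ' * ρ) = ρ⁻¹ * (τ⁻¹ * τ') * ρ := by group
    rw [this]
  constructor
  · intro q q' h
    have := (key _ _).mp h
    rwa [QuotientGroup.out_eq', QuotientGroup.out_eq'] at this
  · intro q
    obtain ⟨γ, hγ⟩ := S.conj_surjective q.out
    refine ⟨((γ * ρ⁻¹ : S.Gl) : S.Gl ⧸ S.Ga b), ?_⟩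
    change ((S.conj _ : S.Gl) : S.Gl ⧸ S.Ga a) = q
    rw [(key _ (γ * ρ⁻¹)).mpr (QuotientGroup.out_eq' _), inv_mul_cancel_right, hγ,
      QuotientGroup.out_eq']

/-! ### Equivariant maps of unit groups, and the choice of a conjugate root -/

/-- The homomorphism `ℤ → kbar(u)^*`, `e ↦ u ^ e`. -/
def uPow : ℤ →+ Additive (RatFunc kbar)ˣ :=
  AddMonoidHom.mk' (fun e : ℤ => Additive.ofMul (uUnit ^ e)) fun e e' => by rw [zpow_add]; rfl

lemma funcRep_uPow (g : S.Gl) (e : ℤ) : S.funcRep g (uPow e) = uPow e := by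
  apply Additive.toMul.injective
  ext
  change coeffHom g.1 (uUnit ^ e : (RatFunc kbar)ˣ).1 = (uUnit ^ e : (RatFunc kbar)ˣ).1
  simp [uUnit, coeffHom_X]

/-- The map induced by `s` on `kbar(u)^*`. -/
def sUnits (S : ConicData k kbar) : Additive (RatFunc kbar)ˣ →+ Additive (RatFunc kbar)ˣ :=
  MonoidHom.toAdditive (Units.map (S.s : RatFunc kbar →* RatFunc kbar))

lemma sUnits_funcRep (g : S.Gl) (z : Additive (RatFunc kbar)ˣ) :
    S.sUnits (S.funcRep (S.conj g) z) = S.funcRep g (S.sUnits z) := by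
  apply Additive.toMul.injective
  ext
  exact RingHom.congr_fun (S.sHom_comp_coeffHom g) _

/-- The inclusion `kbar^* → kbar(u)^*`. -/
def constUnits : Additive kbarˣ →+ Additive (RatFunc kbar)ˣ :=
  MonoidHom.toAdditive (Units.map (algebraMap kbar (RatFunc kbar) : kbar →* RatFunc kbar))

lemma constUnits_injective : Function.Injective (constUnits (kbar := kbar)) :=
  Units.map_injective (algebraMap kbar (RatFunc kbar)).injective

lemma constUnits_constRep (g : S.Gl) (z : Additive kbarˣ) :
    constUnits (S.constRep g z) = S.funcRep g (constUnits z) := by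
  apply Additive.toMul.injective
  ext
  exact (coeffHom_algebraMap g.1 _).symm

lemma inclU_apply (ψ : Character S.Gl) :
    S.inclU ψ = H2.map (ρ := Representation.trivial ℤ S.Gl ℤ) (ρ' := S.funcRep)
      (MonoidHom.id _) continuous_id uPow (fun g e => (funcRep_uPow g e).symm) (delta ψ) := rfl

variable [IsAlgClosure k kbar]

/-- Each root is conjugate to the image under `s` of some chosen root. -/
lemma exists_conjugate_place (S : ConicData k kbar) {e : S.Place → kbar}
    (he : ∀ p : S.Place, aeval (e p) p.1 = 0) (ha : a ≠ 0) :
    ∃ (q : S.Place) (ρ : S.Gl), e q * ρ.1 (S.σ a) = algebraMap k kbar S.c := by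
  have : IsAlgClosed kbar := IsAlgClosure.isAlgClosed k
  have : Normal k kbar := IsAlgClosure.normal k kbar
  have hσ : S.σ a ≠ 0 := by simpa using ha
  have hb0 : algebraMap k kbar S.c / S.σ a ≠ 0 := div_ne_zero S.algebraMap_c_ne_zero hσ
  have hb : IsIntegral S.l (algebraMap k kbar S.c / S.σ a) :=
    (Algebra.IsIntegral.isIntegral (R := k) _).tower_top
  -- The place of the zero of `s(u - a)`; it differs from `u` because `c/σ a ≠ 0`.
  let q : S.Place := ⟨minpoly S.l (algebraMap k kbar S.c / S.σ a), minpoly.monic hb,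
    minpoly.irreducible hb, fun h => hb0 (by
      have := minpoly.aeval S.l (algebraMap k kbar S.c / S.σ a)
      rwa [h, aeval_X] at this)⟩
  obtain ⟨τ, hτ⟩ := minpoly.exists_algEquiv_of_root' hb.isAlgebraic (he q)
  refine ⟨q, (fixingSubgroupEquiv S.l).symm τ, ?_⟩
  change e q * τ (S.σ a) = _
  -- As `τ` carries `c/σ a` to the chosen root, applying it to `(c/σ a) · σ a = c` gives the
  -- relation.
  rw [← hτ, ← map_mul, div_mul_cancel₀ _ hσ]
  exact (((fixingSubgroupEquiv S.l).symm τ).1).commutes S.c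

variable [PerfectField k]

set_option maxHeartbeats 1000000 in
/-- Shapiro's map commutes with conjugation. -/
lemma map_conjInd_shapiro_delta (hab : b * ρ.1 (S.σ a) = algebraMap k kbar S.c)
    (χ : Character (S.Ga a)) :
    H2.map (ρ := indZ (S.Ga a)) (ρ' := indZ (S.Ga b)) S.conj S.continuous_conj (conjInd hab)
      (conjInd_equivariant hab) (shapiro (S.Ga a) (S.isOpen_Ga a) (delta χ)) =
    shapiro (S.Ga b) (S.isOpen_Ga b) (delta
      (Character.comap (conjGa hab).toMonoidHom (continuous_conjGa hab) χ)) := by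
  rw [delta_comap, delta_apply, shapiro_mk, H2.map_mk, H2.map_mk]
  have hc := continuous_retr (S.Ga a) (S.isOpen_Ga a)
  -- Conjugating the retraction for `l(a)` gives an equivariant map for `l(b)` that need not be the
  -- chosen `retr`; Shapiro's class does not see the difference.
  refine mk_eq_shapiro_of_retraction (S.Ga b) (S.isOpen_Ga b)
    (fun g => (conjGa hab).symm (retr (S.Ga a) (S.conj (ρ⁻¹ * g))))
    ((continuous_conjGa_symm hab).comp (hc.comp (S.continuous_conj.comp (by fun_prop)))) ?_ _ _ ?_
  · intro h g
    rw [conj_inv_mul hab, retr_mul, MulEquiv.map_mul, MulEquiv.symm_apply_apply]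
  · intro g h g₀
    have e (x y : S.Ga a) : conjGa hab (((conjGa hab).symm x)⁻¹ * (conjGa hab).symm y) =
        x⁻¹ * y := by
      simp
    have e' (x y : S.Gl) : S.conj (ρ⁻¹ * (x * y)) = S.conj (ρ⁻¹ * x) * S.conj y := by
      rw [← map_mul, mul_assoc]
    change (deltaCocycle χ).1 (_, _) = (deltaCocycle χ).1 (conjGa hab _, conjGa hab _)
    rw [e, e, e', e', e']

/-! #### The action of `s` on the summands of `Br(l(u))` -/

/-- The constant `-σ a`, as a unit. -/
def negσ (S : ConicData k kbar) (ha : a ≠ 0) : kbarˣ := Units.mk0 (-S.σ a) (by simpa using ha)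

/-- The constant factor of `s ∘ ι`. -/
def iotaConst (S : ConicData k kbar) (ha : a ≠ 0) :
    Representation.coindV (S.Ga a).subtype (Representation.trivial ℤ (S.Ga a) ℤ) →+
      Additive kbarˣ where
  toFun x := Additive.ofMul (∏ᶠ q : S.Gl ⧸ S.Ga a,
    S.negσ (a := q.out.1 a) (by simpa using ha) ^ x.1 q.out⁻¹)
  map_zero' := by simp
  map_add' x y := by
    rw [← ofMul_mul, ← finprod_mul_distrib (Set.toFinite _) (Set.toFinite _)]
    simp [zpow_add]

/-- The product `∏ (u - c / σ τ a) ^ x (τ⁻¹)` is in the image of `ι` for the root `b`. -/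
lemma finprod_uSub_eq_iota (hab : b * ρ.1 (S.σ a) = algebraMap k kbar S.c)
    (x : Representation.coindV (S.Ga a).subtype (Representation.trivial ℤ (S.Ga a) ℤ)) :
    Additive.ofMul (∏ᶠ q : S.Gl ⧸ S.Ga a,
      uSub (algebraMap k kbar S.c / S.σ (q.out.1 a)) ^ x.1 q.out⁻¹) =
      S.iota b (conjInd hab x) := by
  change _ = Additive.ofMul (∏ᶠ q : S.Gl ⧸ S.Ga b, uSub (q.out.1 b) ^ (conjInd hab x).1 q.out⁻¹)
  congr 1
  refine (finprod_eq_of_bijective _ (bijective_conj_coset hab) fun q => ?_).symm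
  have hx : x.1 ((S.conj (q.out * ρ) : S.Gl) : S.Gl ⧸ S.Ga a).out⁻¹ =
      x.1 (S.conj (q.out * ρ))⁻¹ := coindV_inv_eq _ x (QuotientGroup.out_eq' _)
  have ha : (((S.conj (q.out * ρ) : S.Gl) : S.Gl ⧸ S.Ga a).out).1 a = (S.conj (q.out * ρ)).1 a := by
    obtain ⟨h, hh⟩ := QuotientGroup.mk_out_eq_mul (S.Ga a) (S.conj (q.out * ρ))
    rw [hh, Subgroup.coe_mul, AlgEquiv.mul_apply, S.apply_of_mem_Ga h.2]
  rw [conjInd_apply, hx, ha, ← map_inv, mul_inv_rev, σ_conj_apply]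
  congr 2
  -- For the representative `τ = q.out`, `c / τ(ρ σ a) = τ(b · ρ σ a) / τ(ρ σ a) = τ b`.
  rw [Subgroup.coe_mul, AlgEquiv.mul_apply, ← AlgEquiv.commutes q.out.1 S.c, ← hab, map_mul,
    mul_div_cancel_right₀]
  rw [map_ne_zero_iff _ q.out.1.injective]
  exact right_ne_zero_of_mul (by rw [hab]; exact S.algebraMap_c_ne_zero)

/-- The product over all conjugates of `a` of the identity `sHom_uSub`: the factors `u⁻¹` collect to
minus the degree, and the factors `u - c/σ τ a` are reindexed as conjugates of `b`. -/
lemma sUnits_iota (ha : a ≠ 0) (hab : b * ρ.1 (S.σ a) = algebraMap k kbar S.c)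
    (x : Representation.coindV (S.Ga a).subtype (Representation.trivial ℤ (S.Ga a) ℤ)) :
    S.sUnits (S.iota a x) = constUnits (S.iotaConst ha x) +
      -uPow (coindDegree (S.Ga a) x) + S.iota b (conjInd hab x) := by
  let := (S.Ga a).fintypeQuotientOfFiniteIndex
  rw [← finprod_uSub_eq_iota hab, ← map_neg]
  change Additive.ofMul (Units.map (S.s : RatFunc kbar →* RatFunc kbar)
    (∏ᶠ q : S.Gl ⧸ S.Ga a, uSub (q.out.1 a) ^ x.1 q.out⁻¹)) = Additive.ofMul (
    Units.map (algebraMap kbar (RatFunc kbar) : kbar →* RatFunc kbar) (∏ᶠ q : S.Gl ⧸ S.Ga a,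
      S.negσ (a := q.out.1 a) (by simpa using ha) ^ x.1 q.out⁻¹)) +
      uPow (-coindDegree (S.Ga a) x) + _
  have hu : uPow (kbar := kbar) (-coindDegree (S.Ga a) x) =
      Additive.ofMul (∏ᶠ q : S.Gl ⧸ S.Ga a, (uUnit⁻¹) ^ x.1 q.out⁻¹) := by
    rw [coindDegree_apply, finsum_eq_sum_of_fintype, finprod_eq_prod_of_fintype,
      ← Finset.sum_neg_distrib, map_sum, ofMul_prod]
    refine Finset.sum_congr rfl fun q _ => ?_
    rw [inv_zpow']
    rfl
  rw [hu, ← ofMul_mul, ← ofMul_mul]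
  simp only [finprod_eq_prod_of_fintype, map_prod, map_zpow]
  rw [← Finset.prod_mul_distrib, ← Finset.prod_mul_distrib]
  congr 1
  refine Finset.prod_congr rfl fun q _ => ?_
  rw [← mul_zpow, ← mul_zpow]
  congr 1
  ext
  exact S.sHom_uSub (by simpa using ha)

/-- No coset computation is needed: in `sUnits_iota` the left side and the other two factors are
equivariant, so the constant factor is too, by cancellation and injectivity of `kbar^* → kbar(u)^*`.
-/
lemma iotaConst_equivariant (ha : a ≠ 0) (hab : b * ρ.1 (S.σ a) = algebraMap k kbar S.c)
    (g : S.Gl) (x : Representation.coindV (S.Ga a).subtype (Representation.trivial ℤ (S.Ga a) ℤ)) :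
    S.iotaConst ha (indZ (S.Ga a) (S.conj g) x) = S.constRep g (S.iotaConst ha x) := by
  have cancel : ∀ {A A' B B' C C' : Additive (RatFunc kbar)ˣ},
      S.funcRep g (A + -B + C) = A' + -B' + C' → S.funcRep g B = B' → S.funcRep g C = C' →
        S.funcRep g A = A' := by
    intro A A' B B' C C' h hB hC
    rw [map_add, map_add, map_neg, hB, hC] at h
    exact add_right_cancel (add_right_cancel h)
  have h := calc
    S.funcRep g (constUnits (S.iotaConst ha x) + -uPow (coindDegree (S.Ga a) x) +
        S.iota b (conjInd hab x)) = S.funcRep g (S.sUnits (S.iota a x)) :=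
      congrArg _ (sUnits_iota ha hab x).symm
    _ = S.sUnits (S.funcRep (S.conj g) (S.iota a x)) := (sUnits_funcRep g _).symm
    _ = S.sUnits (S.iota a (indZ (S.Ga a) (S.conj g) x)) :=
      congrArg _ (S.iota_equivariant a (S.conj g) x).symm
    _ = _ := sUnits_iota ha hab _
  refine constUnits_injective (Eq.trans ?_ (constUnits_constRep g (S.iotaConst ha x)).symm)
  refine (cancel h ?_ ?_).symm
  · exact (funcRep_uPow g _).trans (congrArg uPow (coindDegree_indZ (S.Ga a) (S.conj g) x).symm)
  · exact (S.iota_equivariant b g _).symm.trans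
      (congrArg (S.iota b) (conjInd_equivariant hab g x).symm)

lemma inclA_apply (χ : Character (S.Ga a)) :
    S.inclA a χ = H2.map (ρ := indZ (S.Ga a)) (ρ' := S.funcRep) (MonoidHom.id _) continuous_id
      (S.iota a) (S.iota_equivariant a) (shapiro (S.Ga a) (S.isOpen_Ga a) (delta χ)) := rfl

/-- `sUnits_iota` applied to each value of a cocycle, so the splitting holds on cocycles and not
only on classes. -/
lemma sStar_map_iota (ha : a ≠ 0) (hab : b * ρ.1 (S.σ a) = algebraMap k kbar S.c)
    (y : H2 (indZ (S.Ga a))) :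
    S.sStar (H2.map (ρ := indZ (S.Ga a)) (ρ' := S.funcRep) (MonoidHom.id _) continuous_id
      (S.iota a) (S.iota_equivariant a) y) =
    S.inclBr (H2.map S.conj S.continuous_conj (S.iotaConst ha) (iotaConst_equivariant ha hab) y) +
    -H2.map (ρ := Representation.trivial ℤ S.Gl ℤ) (ρ' := S.funcRep)
      (MonoidHom.id _) continuous_id uPow (fun g e => (funcRep_uPow g e).symm)
      (H2.map (ρ := Representation.trivial ℤ S.Gl ℤ) (ρ' := Representation.trivial ℤ S.Gl ℤ)
        S.conj S.continuous_conj (AddMonoidHom.id ℤ) (by simp)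
        (H2.map (ρ := indZ (S.Ga a)) (ρ' := Representation.trivial ℤ S.Gl ℤ) (MonoidHom.id _)
          continuous_id (coindDegree (S.Ga a)) (coindDegree_equivariant (S.Ga a)) y)) +
    H2.map (ρ := indZ (S.Ga b)) (ρ' := S.funcRep) (MonoidHom.id _) continuous_id
      (S.iota b) (S.iota_equivariant b) (H2.map (ρ := indZ (S.Ga a)) (ρ' := indZ (S.Ga b))
        S.conj S.continuous_conj (conjInd hab) (conjInd_equivariant hab) y) := by
  obtain ⟨F, rfl⟩ := H2.mk_surjective y
  have h : ∀ q : S.Gl × S.Gl, _ := fun q => sUnits_iota ha hab (F.1 (S.conj q.1, S.conj q.2))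
  exact congrArg (H2.mk S.funcRep) (Subtype.ext (funext h))

/-- The action of `s` on the summand belonging to `a`. -/
lemma sStar_inclA (ha : a ≠ 0) (hab : b * ρ.1 (S.σ a) = algebraMap k kbar S.c)
    (χ : Character (S.Ga a)) : ∃ β, S.sStar (S.inclA a χ) = S.inclBr β +
      -S.inclU (S.sigmaX (S.corA a χ)) + S.inclA b
        (Character.comap (conjGa hab).toMonoidHom (continuous_conjGa hab) χ) := by
  refine ⟨H2.map S.conj S.continuous_conj (S.iotaConst ha) (iotaConst_equivariant ha hab)
    (shapiro (S.Ga a) (S.isOpen_Ga a) (delta χ)), ?_⟩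
  rw [inclU_apply, inclA_apply, inclA_apply, ← map_conjInd_shapiro_delta hab χ,
    show delta (S.sigmaX (S.corA a χ)) = _ from delta_comap S.conj S.continuous_conj _,
    show delta (S.corA a χ) = _ from
      (map_coindDegree_shapiro_delta (S.Ga a) (S.isOpen_Ga a) χ).symm]
  exact sStar_map_iota ha hab _

end ConicData

end GenusZero

/-! ### Reading off the component at `u` -/

theorem mainTheorem7 {k kbar : Type*} [Field k] [PerfectField k] [Field kbar] [Algebra k kbar]
    [IsAlgClosure k kbar] (S : GenusZero.ConicData k kbar)
    (a : S.Place → kbar) (ha : ∀ p : S.Place, Polynomial.aeval (a p) p.1 = 0)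
    (p : S.Place) (χ : GenusZero.Character (S.Ga (a p))) (ψ : GenusZero.Character S.Gl) :
    (∃ (β : S.BrL) (ξ : ⨁ q : S.Place, GenusZero.Character (S.Ga (a q))),
      S.sStar (S.decomp a
        (0, 0, DirectSum.of (fun q : S.Place => GenusZero.Character (S.Ga (a q))) p χ)) =
          S.decomp a (β, ψ, ξ)) ↔
      ψ = -S.sigmaX (S.corA (a p) χ) := by
  have ha0 : ∀ q, a q ≠ 0 := fun q => S.root_ne_zero q (ha q)
  obtain ⟨q, ρ, hq⟩ := S.exists_conjugate_place ha (ha0 p)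
  obtain ⟨β, hβ⟩ := GenusZero.ConicData.sStar_inclA (ha0 p) hq χ
  have key : S.sStar (S.decomp a
      (0, 0, DirectSum.of (fun q : S.Place => GenusZero.Character (S.Ga (a q))) p χ)) =
      S.decomp a (β, -S.sigmaX (S.corA (a p) χ),
        DirectSum.of (fun q : S.Place => GenusZero.Character (S.Ga (a q))) q
          (GenusZero.Character.comap (GenusZero.ConicData.conjGa hq).toMonoidHom
            (GenusZero.ConicData.continuous_conjGa hq) χ)) := by
    simp only [GenusZero.ConicData.decomp, AddMonoidHom.coprod_apply, map_zero, zero_add,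
      DirectSum.toAddMonoid_of, map_neg]
    rw [hβ, add_assoc]
  constructor
  · rintro ⟨β', ξ', h⟩
    -- Any other decomposition of the same class has the same ramification at `u = 0`, hence the
    -- same `X(l)`-component.
    have h1 := congrArg S.ramZero (h.symm.trans key)
    rw [S.ramZero_decomp ha0, S.ramZero_decomp ha0] at h1
    exact GenusZero.delta_injective h1
  · rintro rfl
    exact ⟨_, _, key⟩

end
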